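/- Let $a>1/2$, $b<\pi/2$ and $C>0$ be real numbers, and let $g$ be an odd function that is analytic in the vertical strip $|\mathrm{Re}(z)|<a$, except for a simple pole at $z=0$ with residue one. Assume that $$|g(z)|<C e^{b|\mathrm{Im}(z)|/2}\quad\text{for all } z \text{ with } |\mathrm{Re}(z)|<a \text{ and } |\mathrm{Im}(z)|>1.$$ Below, $x$ and $\tau$ are points of the Riemann surface of the logarithm, so that $\arg(x)$ may be any real number and powers are $x^{s}=e^{s\log x}$; a sector $|\arg(x)|<\theta$ with $\theta\le\pi$ is simply a sector of $\mathbb{C}\setminus\{0\}$ with the principal argument. Positive real numbers have argument $0$. Put $$\mathcal D_{a,b}=\{(s,x):\ \mathrm{Re}(s)>-a,\ x\ne 0,\ |\arg(x)|<\tfrac{\pi}{2}-b\}.$$ (i) There exists a function $h(s,x)$, analytic in $\mathcal D_{a,b}$, such that for all complex $s$, $w$ with $\mathrm{Re}(s)>-a$ and $\frac12\max(0,\mathrm{Re}(s))<\mathrm{Re}(w)<\frac12(a+\mathrm{Re}(s))$ the following integral converges absolutely and $$\int_0^\infty h(s,x)x^{w-1}\,dx=\Gamma(w)g(2w-s).$$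 (ii) Let $h$ be any function as in (i). For every $\tau$ with $|\arg(\tau)|<\frac{\pi}{2}-b$ and every $s\notin\{0,1\}$ in the strip $1-a<\mathrm{Re}(s)<a$, $$\pi^{-s/2}\Gamma(s/2)\zeta(s)=\tau^{s/2}\Big[-g(s)+2\sum_{n\ge1}h(s,\pi\tau n^2)\Big]+\tau^{(s-1)/2}\Big[-g(1-s)+2\sum_{n\ge1}h(1-s,\pi\tau^{-1}n^2)\Big],$$ where the left-hand side is understood as its analytic continuation at $s=-2,-4,\dots$. Both series converge absolutely at every point of the strip $1-a<\mathrm{Re}(s)<a$; both series, and the series of the absolute values of their terms, converge uniformly on every compact subset of this strip. -/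

import Mathlib

open Complex Set Filter Topology

noncomputable section

/-- The Riemann surface of the logarithm: a point `x` is given by its logarithm `log x ∈ ℂ`, which
is a global chart of the surface. The real part of `log x` is `log |x|` and its imaginary part is
the argument of `x`, which may be any real number. The sector `|arg x| < θ` of the surface is
a sector of the punctured plane when `θ ≤ π`. -/
@[ext] structure LogSurface where
  log : ℂ

namespace LogSurface

/-- The argument of a point, a real number (not reduced modulo `2π`). -/
def arg (x : LogSurface) : ℝ := x.log.im

/-- The power `x ^ s = exp (s * log x)`. -/
def cpow (x : LogSurface) (s : ℂ) : ℂ := Complex.exp (s * x.log)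

/-- The positive real number `r`, as the point of the surface with modulus `r` and argument `0`. -/
def ofReal (r : ℝ) : LogSurface := ⟨(Real.log r : ℂ)⟩

/-- The product: moduli multiply, arguments add. -/
instance : Mul LogSurface := ⟨fun x y => ⟨x.log + y.log⟩⟩

/-- The inverse: the modulus is inverted, the argument changes its sign. -/
instance : Inv LogSurface := ⟨fun x => ⟨-x.log⟩⟩

end LogSurface

/-- `h(s, x)` is analytic in the domain `Re s > -a`, `|arg x| < π / 2 - b`: in the chart `log x` it
is a function of two complex variables, (jointly) complex differentiable on an open subset
of `ℂ × ℂ`. -/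
def AnalyticOnDomain (a b : ℝ) (h : ℂ → LogSurface → ℂ) : Prop :=
  DifferentiableOn ℂ (fun p : ℂ × ℂ => h p.1 ⟨p.2⟩)
    {p : ℂ × ℂ | -a < p.1.re ∧ |(⟨p.2⟩ : LogSurface).arg| < Real.pi / 2 - b}

/-- For `Re s > -a` and `max (0, Re s) / 2 < Re w < (a + Re s) / 2`, the Mellin integral
`∫₀^∞ h(s, x) x ^ (w - 1) dx` converges absolutely and is equal to `Γ(w) g(2w - s)`. -/
def HasMellinGamma (a : ℝ) (g : ℂ → ℂ) (h : ℂ → LogSurface → ℂ) : Prop :=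
  ∀ s w : ℂ, -a < s.re → max 0 s.re / 2 < w.re → w.re < (a + s.re) / 2 →
    HasMellin (fun x : ℝ => h s (LogSurface.ofReal x)) w (Gamma w * g (2 * w - s))

/-- The series `∑ f n s` converges absolutely at each point `s` of `U`, and it and the series of
the absolute values converge uniformly on each compact subset of `U`. -/
def ConvergesAbsUniformly (f : ℕ → ℂ → ℂ) (U : Set ℂ) : Prop :=
  (∀ s ∈ U, Summable fun n => ‖f n s‖) ∧
  ∀ K : Set ℂ, K ⊆ U → IsCompact K →
    TendstoUniformlyOn (fun (N : ℕ) s => ∑ n ∈ Finset.range N, f n s)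
      (fun s => ∑' n, f n s) atTop K ∧
    TendstoUniformlyOn (fun (N : ℕ) s => ∑ n ∈ Finset.range N, ‖f n s‖)
      (fun s => ∑' n, ‖f n s‖) atTop K

/-- `completedRiemannZeta s` is `π ^ (-s / 2) Γ(s / 2) ζ(s)`, with its removable singularities at
`-2, -4, …` removed. -/
theorem completedRiemannZeta_eq_mul {s : ℂ} (hs : ∀ k : ℕ, s ≠ -(2 * k)) :
    completedRiemannZeta s = (Real.pi : ℂ) ^ (-s / 2) * Gamma (s / 2) * riemannZeta s := by
  have h0 : s ≠ 0 := by simpa using hs 0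
  have h1 : Gammaℝ s ≠ 0 := fun h => by
    obtain ⟨k, hk⟩ := Gammaℝ_eq_zero_iff.mp h
    exact hs k hk
  rw [riemannZeta_def_of_ne_zero h0, ← Gammaℝ_def, mul_div_cancel₀ _ h1]

end

/-! The function `h` is the inverse Mellin integral `h(s, x) = (1/2πi) ∫ Γ(w) g(2w - s) x^(-w) dw`
along a line `Re w = c`. On it `Γ(w)` decays like `exp(-θ |Im w|)` for every `θ < π/2`, while `g(2w
- s)` and `x^(-w)` grow at most at the rates `b` and `|arg x|`. Hence the sector `|arg x| < π/2 -
b`, where the integral is holomorphic in both variables (`exists_norm_mellinKernel_le`). Fourier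
inversion gives its Mellin transform. Conversely, Mellin inversion on the positive axis and the
identity theorem show that every `h` as in (i) is this integral (`eq_mellinKernelIntegral`), so (ii)
need only be proved for it.

Write `Λ` for `completedRiemannZeta`. If `2c > 1`, summing over `n` under the integral produces
`Λ(2w)`, and `v = 2w - s` gives `τ^(s/2) · 2 ∑ h(s, πτn²) = (1/2πi) ∫ Λ(v + s) g(v) τ^(-v/2) dv` on
a line `Re v = d₁ > 0` (`two_mul_tsum`). Replacing `v` by `-v` and using `Λ(1 - u) = Λ(u)` and the
oddness of `g`, the second series becomes minus the same integral on a line `Re v = -d₂ < 0`. The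
two series together are therefore the sum of the residues between the lines
(`integral_zetaKernel_sub`): `Λ(s)` at `v = 0`, `g(1 - s) τ^((s-1)/2)` at `v = 1 - s` and `g(s)
τ^(s/2)` at `v = -s`. Solving for `Λ(s)` is the theorem.

Moving the line requires exponential decay of `Λ` at every rate below `π/4` in vertical strips,
which comes from Phragmén–Lindelöf (`exists_norm_completedRiemannZeta_le`). -/

noncomputable section

/-! ### Holomorphic parameter integrals and residues in vertical strips -/

section ContourIntegrals

open MeasureTheory

/-- A holomorphic integrand that is dominated on a ball has a holomorphic integral. -/
theorem differentiableAt_integral_prod_of_dominated {α : Type*} [MeasurableSpace α] {μ : Measure α}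
    {F : ℂ × ℂ → α → ℂ} {x₀ : ℂ × ℂ} {r : ℝ} (hr : 0 < r) {bound : α → ℝ}
    (hmeas : ∀ x ∈ Metric.ball x₀ r, AEStronglyMeasurable (F x) μ)
    (hdiff : ∀ t, DifferentiableOn ℂ (fun x => F x t) (Metric.ball x₀ r))
    (hbound : ∀ᵐ t ∂μ, ∀ x ∈ Metric.ball x₀ r, ‖F x t‖ ≤ bound t)
    (hint : Integrable bound μ) :
    DifferentiableAt ℂ (fun x => ∫ t, F x t ∂μ) x₀ := by
  have hr2 : 0 < r / 2 := by positivity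
  have hsub : ∀ x ∈ Metric.ball x₀ (r / 2), Metric.ball x (r / 2) ⊆ Metric.ball x₀ r := by
    intro x hx
    apply Metric.ball_subset_ball'
    rw [Metric.mem_ball] at hx
    linarith
  have hx₀ : x₀ ∈ Metric.ball x₀ r := Metric.mem_ball_self hr
  have hd₀ : ∀ t, HasFDerivAt (fun x => F x t) (fderiv ℂ (fun x => F x t) x₀) x₀ := fun t =>
    ((hdiff t).differentiableAt (Metric.ball_mem_nhds x₀ hr)).hasFDerivAt
  -- Measurability of the derivative in `t`: along a fixed direction it is a pointwise limit of
  -- difference quotients, and two directions determine it.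
  have hdir : ∀ e : ℂ × ℂ,
      AEStronglyMeasurable (fun t => fderiv ℂ (fun x => F x t) x₀ e) μ := by
    intro e
    obtain ⟨u, hu⟩ := exists_seq_tendsto (𝓝[≠] (0 : ℂ))
    have hmem : ∀ᶠ n in atTop, x₀ + u n • e ∈ Metric.ball x₀ r := by
      have h1 : Tendsto (fun n => x₀ + u n • e) atTop (𝓝 (x₀ + (0 : ℂ) • e)) :=
        tendsto_const_nhds.add ((tendsto_nhdsWithin_iff.mp hu).1.smul_const e)
      rw [zero_smul, add_zero] at h1
      exact h1 (Metric.ball_mem_nhds x₀ hr)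
    obtain ⟨N, hN⟩ := eventually_atTop.mp hmem
    refine aestronglyMeasurable_of_tendsto_ae atTop
      (f := fun n t => (u (n + N))⁻¹ • (F (x₀ + u (n + N) • e) t - F x₀ t)) ?_ ?_
    · intro n
      exact ((hmeas _ (hN (n + N) (by lia))).sub (hmeas _ hx₀)).const_smul (u (n + N))⁻¹
    · refine Eventually.of_forall fun t => ?_
      have h2 := ((hd₀ t).hasLineDerivAt e)
      have h3 := hasLineDerivAt_iff_tendsto_slope_zero.mp h2
      exact h3.comp (hu.comp (tendsto_add_atTop_nat N))
  -- Cauchy's estimate on the ball of radius `r / 2` about `x`, which stays inside the large ball.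
  have hbd : ∀ᵐ t ∂μ, ∀ x ∈ Metric.ball x₀ (r / 2),
      ‖fderiv ℂ (fun x => F x t) x‖ ≤ 2 * bound t / (r / 2) := by
    filter_upwards [hbound] with t ht x hx
    refine norm_fderiv_le_div_of_mapsTo_ball ((hdiff t).mono (hsub x hx)) ?_ hr2
    intro z hz
    rw [mem_closedBall_iff_norm]
    have h1 := ht z (hsub x hx hz)
    have h2 := ht x (hsub x hx (Metric.mem_ball_self hr2))
    have h3 := norm_sub_le (F z t) (F x t)
    linarith
  refine (hasFDerivAt_integral_of_dominated_of_fderiv_le (μ := μ) (F := F)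
    (F' := fun x t => fderiv ℂ (fun x => F x t) x) (bound := fun t => 2 * bound t / (r / 2))
    (s := Metric.ball x₀ (r / 2))
    (Metric.ball_mem_nhds x₀ hr2) ?_ ?_ ?_ ?_ ?_ ?_).differentiableAt
  · filter_upwards [Metric.ball_mem_nhds x₀ hr] with x hx using hmeas x hx
  · exact hint.mono' (hmeas _ hx₀) (hbound.mono fun t ht => ht _ hx₀)
  · have h1 : (fun t => fderiv ℂ (fun x => F x t) x₀) = fun t =>
        fderiv ℂ (fun x => F x t) x₀ (1, 0) • ContinuousLinearMap.fst ℂ ℂ ℂ +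
        fderiv ℂ (fun x => F x t) x₀ (0, 1) • ContinuousLinearMap.snd ℂ ℂ ℂ := by
      funext t
      ext <;> simp
    rw [h1]
    exact ((hdir _).smul_const _).add ((hdir _).smul_const _)
  · exact hbd
  · exact (hint.const_mul 2).div_const _
  · refine Eventually.of_forall fun t x hx => ?_
    exact ((hdiff t).differentiableAt (Metric.isOpen_ball.mem_nhds
      (hsub x hx (Metric.mem_ball_self hr2)))).hasFDerivAt

theorem differentiableAt_integral_of_dominated_ball {α : Type*} [MeasurableSpace α] {μ : Measure α}
    {F : ℂ → α → ℂ} {x₀ : ℂ} {r : ℝ} (hr : 0 < r) {bound : α → ℝ}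
    (hmeas : ∀ x ∈ Metric.ball x₀ r, AEStronglyMeasurable (F x) μ)
    (hdiff : ∀ t, DifferentiableOn ℂ (fun x => F x t) (Metric.ball x₀ r))
    (hbound : ∀ᵐ t ∂μ, ∀ x ∈ Metric.ball x₀ r, ‖F x t‖ ≤ bound t)
    (hint : Integrable bound μ) :
    DifferentiableAt ℂ (fun x => ∫ t, F x t ∂μ) x₀ := by
  have hmem : ∀ p ∈ Metric.ball (x₀, (0 : ℂ)) r, p.1 ∈ Metric.ball x₀ r := by
    intro p hp
    rw [← ball_prod_same] at hp
    exact hp.1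
  have h := differentiableAt_integral_prod_of_dominated (μ := μ) (F := fun p t => F p.1 t)
    (x₀ := (x₀, 0)) hr (bound := bound) (fun p hp => hmeas _ (hmem p hp))
    (fun t => (hdiff t).comp differentiable_fst.differentiableOn hmem)
    (hbound.mono fun t ht p hp => ht _ (hmem p hp)) hint
  exact h.comp x₀ (f := fun x : ℂ => (x, (0 : ℂ))) (by fun_prop)

theorem integrable_of_continuous_of_quadratic_decay {f : ℝ → ℂ} (hf : Continuous f) {M T : ℝ}
    (hM : ∀ y, T ≤ |y| → ‖f y‖ ≤ M / (1 + y ^ 2)) : Integrable f := by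
  have hint : Integrable (fun y : ℝ => (1 + y ^ 2)⁻¹) := integrable_inv_one_add_sq
  refine hf.locallyIntegrable.integrable_of_isBigO_cocompact (g := fun y : ℝ => (1 + y ^ 2)⁻¹) ?_
    (hint.integrableAtFilter _)
  refine Asymptotics.IsBigO.of_bound M ?_
  have h : ∀ᶠ y : ℝ in cocompact ℝ, T ≤ ‖y‖ := tendsto_norm_cocompact_atTop.eventually_ge_atTop T
  filter_upwards [h] with y hy
  have := hM y hy
  rwa [Real.norm_of_nonneg (by positivity), ← div_eq_mul_inv]

theorem integral_univ_div_sq_add_sq (σ : ℝ) (hσ : σ ≠ 0) :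
    ∫ y : ℝ, σ / (σ ^ 2 + y ^ 2) = Real.pi * SignType.sign σ := by
  have h : ∀ y : ℝ, σ / (σ ^ 2 + y ^ 2) = σ⁻¹ * (1 + (y / σ) ^ 2)⁻¹ := by
    intro y
    have h1 : σ ^ 2 + y ^ 2 ≠ 0 := by positivity
    have h2 : 1 + (y / σ) ^ 2 ≠ 0 := by positivity
    field_simp
  simp_rw [h]
  rw [integral_const_mul, Measure.integral_comp_div (fun y => (1 + y ^ 2)⁻¹) σ,
    integral_univ_inv_one_add_sq, smul_eq_mul]
  rcases lt_or_gt_of_ne hσ with h' | h'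
  · rw [abs_of_neg h', sign_neg h']; simp; field_simp
  · rw [abs_of_pos h', sign_pos h']; simp; field_simp

/-- A non-integrable function has integral `0` by convention, but the value just computed is `±π`.
-/
theorem integrable_div_sq_add_sq (σ : ℝ) (hσ : σ ≠ 0) :
    Integrable fun y : ℝ => σ / (σ ^ 2 + y ^ 2) := by
  by_contra h
  have h1 := integral_univ_div_sq_add_sq σ hσ
  rw [integral_undef h] at h1
  rcases lt_or_gt_of_ne hσ with h' | h'
  · rw [sign_neg h'] at h1; simp [Real.pi_ne_zero] at h1
  · rw [sign_pos h'] at h1; simp [Real.pi_ne_zero.symm] at h1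

theorem add_mul_I_ne_zero {σ : ℝ} (hσ : σ ≠ 0) (y : ℝ) : (σ : ℂ) + y * I ≠ 0 := by
  intro h
  apply hσ
  simpa using congrArg re h

theorem norm_inv_sub_inv_le (z w : ℂ) (him : z.im = w.im) (hz : 1 ≤ |z.im|) :
    ‖z⁻¹ - w⁻¹‖ ≤ 2 * ‖w - z‖ / (1 + z.im ^ 2) := by
  have hz0 : z ≠ 0 := by rintro rfl; simp at hz; linarith
  have hw0 : w ≠ 0 := by rintro rfl; simp at him; simp [him] at hz; linarith
  rw [inv_sub_inv hz0 hw0, norm_div, norm_mul]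
  have h1 : |z.im| ≤ ‖z‖ := abs_im_le_norm z
  have h2 : |z.im| ≤ ‖w‖ := him ▸ abs_im_le_norm w
  have h3 : z.im ^ 2 ≤ ‖z‖ * ‖w‖ := by
    rw [← sq_abs, sq]
    exact mul_le_mul h1 h2 (abs_nonneg _) (norm_nonneg _)
  have h4 : 1 ≤ z.im ^ 2 := by rw [← sq_abs]; nlinarith
  rw [div_le_div_iff₀ (by nlinarith) (by positivity)]
  nlinarith [norm_nonneg (w - z)]

theorem integrable_inv_sub_inv (σ τ : ℝ) (hσ : σ ≠ 0) (hτ : τ ≠ 0) :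
    Integrable fun y : ℝ => ((σ : ℂ) + y * I)⁻¹ - ((τ : ℂ) + y * I)⁻¹ := by
  refine integrable_of_continuous_of_quadratic_decay (M := 2 * ‖(τ : ℂ) - σ‖) (T := 1) ?_ ?_
  · exact (Continuous.inv₀ (by fun_prop) (add_mul_I_ne_zero hσ)).sub
      (Continuous.inv₀ (by fun_prop) (add_mul_I_ne_zero hτ))
  · intro y hy
    have := norm_inv_sub_inv_le ((σ : ℂ) + y * I) ((τ : ℂ) + y * I) (by simp) (by simpa using hy)
    simpa using this

/-- Averaging over `y ↦ -y` leaves the difference of two Poisson kernels, each with integral `±π`.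
Only the difference of the inverses is integrable. -/
theorem integral_inv_sub_inv (σ τ : ℝ) (hσ : σ ≠ 0) (hτ : τ ≠ 0) :
    ∫ y : ℝ, (((σ : ℂ) + y * I)⁻¹ - ((τ : ℂ) + y * I)⁻¹) =
      Real.pi * (SignType.sign σ : ℝ) - Real.pi * (SignType.sign τ : ℝ) := by
  set D : ℝ → ℂ := fun y : ℝ => ((σ : ℂ) + y * I)⁻¹ - ((τ : ℂ) + y * I)⁻¹ with hD
  have hint : Integrable D := integrable_inv_sub_inv σ τ hσ hτ
  have hsum : ∀ y, D y + D (-y) =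
      ((2 * (σ / (σ ^ 2 + y ^ 2) - τ / (τ ^ 2 + y ^ 2)) : ℝ) : ℂ) := by
    have key : ∀ (σ : ℝ), σ ≠ 0 → ∀ y : ℝ, ((σ : ℂ) + y * I)⁻¹ + ((σ : ℂ) + (-y : ℝ) * I)⁻¹ =
        ((2 * (σ / (σ ^ 2 + y ^ 2)) : ℝ) : ℂ) := by
      intro σ hσ y
      have h1 := add_mul_I_ne_zero hσ y
      have h2 := add_mul_I_ne_zero hσ (-y)
      have h3 : σ ^ 2 + y ^ 2 ≠ 0 := by positivity
      have h4 : ((σ : ℂ) ^ 2 + (y : ℂ) ^ 2) = ((σ : ℂ) + y * I) * ((σ : ℂ) + (-y : ℝ) * I) := by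
        push_cast; ring_nf; rw [I_sq]; ring
      push_cast
      rw [h4]
      push_cast at h2 ⊢
      rw [inv_add_inv h1 h2, mul_div_assoc']
      congr 1
      ring
    intro y
    have e1 := key σ hσ y
    have e2 := key τ hτ y
    simp only [hD]
    push_cast at e1 e2 ⊢
    linear_combination e1 - e2
  have h2 : ∫ y, (D y + D (-y)) = 2 * ∫ y, D y := by
    rw [integral_add hint hint.comp_neg, integral_neg_eq_self]
    ring
  simp_rw [hsum] at h2
  rw [integral_complex_ofReal, integral_const_mul,
    integral_sub (integrable_div_sq_add_sq σ hσ) (integrable_div_sq_add_sq τ hτ),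
    integral_univ_div_sq_add_sq σ hσ, integral_univ_div_sq_add_sq τ hτ] at h2
  push_cast at h2 ⊢
  linear_combination -h2 / 2

theorem integrable_vertical_of_quadratic_decay {f : ℂ → ℂ} {α β σ M T : ℝ}
    (hσ : σ ∈ Icc α β) {S : Set ℂ} (hS : ∀ p ∈ S, p.re ≠ σ)
    (hf : DifferentiableOn ℂ f ((re ⁻¹' Icc α β) \ S))
    (hdecay : ∀ v : ℂ, v.re ∈ Icc α β → T ≤ |v.im| → ‖f v‖ ≤ M / (1 + v.im ^ 2)) :
    Integrable fun y : ℝ => f (σ + y * I) := by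
  refine integrable_of_continuous_of_quadratic_decay (M := M) (T := T) ?_ ?_
  · refine hf.continuousOn.comp_continuous (by fun_prop) fun y => ⟨by simpa using hσ, fun hm => ?_⟩
    exact hS _ hm (by simp)
  · intro y hy
    simpa using hdecay (σ + y * I) (by simpa using hσ) (by simpa using hy)

/-- Cauchy's theorem for a vertical strip. -/
theorem integral_vertical_eq_of_differentiableOn {f : ℂ → ℂ} {α β M T : ℝ} (hαβ : α ≤ β)
    (hf : DifferentiableOn ℂ f (re ⁻¹' Icc α β))
    (hdecay : ∀ v : ℂ, v.re ∈ Icc α β → T ≤ |v.im| → ‖f v‖ ≤ M / (1 + v.im ^ 2)) :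
    ∫ y : ℝ, f (β + y * I) = ∫ y : ℝ, f (α + y * I) := by
  have hint : ∀ σ ∈ Icc α β, Integrable fun y : ℝ => f (σ + y * I) := fun σ hσ =>
    integrable_vertical_of_quadratic_decay (S := ∅) hσ (by simp) (by simpa using hf) hdecay
  have hlim : ∀ σ ∈ Icc α β, Tendsto (fun R : ℝ => ∫ y : ℝ in (-R)..R, f (σ + y * I)) atTop
      (𝓝 (∫ y : ℝ, f (σ + y * I))) := fun σ hσ =>
    intervalIntegral_tendsto_integral (hint σ hσ) tendsto_neg_atTop_atBot tendsto_id
  -- The horizontal sides of the rectangle vanish in the limit; `e = 1` is the top and `e = -1` the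
  -- bottom.
  have hhor : ∀ e : ℝ, |e| = 1 →
      Tendsto (fun R : ℝ => ∫ x : ℝ in α..β, f (x + (e * R : ℝ) * I)) atTop (𝓝 0) := by
    intro e he
    rw [tendsto_zero_iff_norm_tendsto_zero]
    have h0 : Tendsto (fun R : ℝ => M / (1 + R ^ 2) * |β - α|) atTop (𝓝 0) := by
      have : Tendsto (fun R : ℝ => M / (1 + R ^ 2)) atTop (𝓝 0) :=
        tendsto_const_nhds.div_atTop
          (tendsto_atTop_add_const_left _ _ (tendsto_pow_atTop two_ne_zero))
      simpa using this.mul_const |β - α|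
    refine squeeze_zero' (Eventually.of_forall fun _ => norm_nonneg _) ?_ h0
    filter_upwards [eventually_ge_atTop T, eventually_ge_atTop 0] with R hR hR0
    refine intervalIntegral.norm_integral_le_of_norm_le_const fun x hx => ?_
    rw [uIoc_of_le hαβ] at hx
    have h1 : |e * R| = R := by rw [abs_mul, he, one_mul, abs_of_nonneg hR0]
    have h2 := hdecay (x + (e * R : ℝ) * I) (by simpa using ⟨hx.1.le, hx.2⟩)
      (by simpa [abs_mul, he, abs_of_nonneg hR0] using hR)
    have h3 : ((x : ℂ) + (e * R : ℝ) * I).im ^ 2 = R ^ 2 := by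
      rw [← sq_abs]; simp [abs_mul, he]
    rwa [h3] at h2
  have hrect : ∀ R : ℝ, I * (∫ y : ℝ in (-R)..R, f (β + y * I)) -
      I * (∫ y : ℝ in (-R)..R, f (α + y * I)) =
      (∫ x : ℝ in α..β, f (x + (1 * R : ℝ) * I)) -
        ∫ x : ℝ in α..β, f (x + ((-1) * R : ℝ) * I) := by
    intro R
    have h := integral_boundary_rect_eq_zero_of_differentiableOn f ((α : ℂ) + (-R : ℝ) * I)
      ((β : ℂ) + (R : ℝ) * I) (hf.mono ?_)
    · simp only [add_re, ofReal_re, mul_re, I_re, mul_zero, ofReal_im, I_im, mul_one, sub_self,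
        add_zero, add_im, mul_im, zero_add, smul_eq_mul] at h
      rw [one_mul, neg_one_mul]
      linear_combination h
    · intro v hv
      have := hv.1
      simpa [uIcc_of_le hαβ] using this
  have hL := ((hlim β (right_mem_Icc.mpr hαβ)).const_mul I).sub
    ((hlim α (left_mem_Icc.mpr hαβ)).const_mul I)
  have hR := (hhor 1 (by simp)).sub (hhor (-1) (by simp))
  have := tendsto_nhds_unique hL (hR.congr fun R => (hrect R).symm)
  have h2 : I * ((∫ y : ℝ, f (β + y * I)) - ∫ y : ℝ, f (α + y * I)) = 0 := by
    rw [sub_zero] at this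
    linear_combination this
  exact sub_eq_zero.mp ((mul_eq_zero.mp h2).resolve_left I_ne_zero)

/-- The residue theorem for a vertical strip and simple poles. -/
theorem integral_vertical_sub_eq_sum_residues {α β : ℝ} (hαβ : α ≤ β) (r : ℂ → ℂ) (S : Finset ℂ) :
    ∀ {f : ℂ → ℂ} {M T : ℝ}, (∀ p ∈ S, p.re ∈ Ioo α β) →
    DifferentiableOn ℂ f ((re ⁻¹' Icc α β) \ S) →
    (∀ p ∈ S, Tendsto (fun v => (v - p) * f v) (𝓝[≠] p) (𝓝 (r p))) →
    (∀ v : ℂ, v.re ∈ Icc α β → T ≤ |v.im| → ‖f v‖ ≤ M / (1 + v.im ^ 2)) →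
    (∫ y : ℝ, f (β + y * I)) - (∫ y : ℝ, f (α + y * I)) = 2 * Real.pi * ∑ p ∈ S, r p := by
  induction S using Finset.induction_on with
  | empty =>
    intro f M T _ hf _ hdecay
    rw [integral_vertical_eq_of_differentiableOn hαβ (by simpa using hf) hdecay]
    simp
  | insert p S hpS ih =>
    intro f M T hS hf hres hdecay
    have hp : p.re ∈ Ioo α β := hS p (Finset.mem_insert_self _ _)
    -- The auxiliary pole `q` lies outside the strip, at the height of `p`. It makes `K` decay
    -- quadratically while `K` keeps residue `1` at `p`, so that `f - r p * K` has one pole fewer;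
    -- crossing `p` changes the integral of `K` by `2π`.
    set q : ℂ := ((α - 1 : ℝ) : ℂ) + p.im * I with hq
    have hqre : q.re = α - 1 := by simp [hq]
    have hqim : q.im = p.im := by simp [hq]
    set K : ℂ → ℂ := fun v => (v - p)⁻¹ - (v - q)⁻¹ with hK
    have hKdiff : ∀ v, v ≠ p → v ≠ q → DifferentiableAt ℂ K v := by
      intro v h1 h2
      have h1' := sub_ne_zero.mpr h1
      have h2' := sub_ne_zero.mpr h2
      simp only [hK]
      fun_prop (disch := assumption)
    have hstrip_q : ∀ v : ℂ, v.re ∈ Icc α β → v ≠ q := by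
      rintro v hv rfl
      rw [mem_Icc, hqre] at hv
      linarith [hv.1]
    have hKint : ∀ σ : ℝ, ∫ y : ℝ, K (σ + y * I) =
        ∫ y : ℝ, ((((σ - p.re : ℝ) : ℂ) + y * I)⁻¹ - (((σ - q.re : ℝ) : ℂ) + y * I)⁻¹) := by
      intro σ
      rw [← integral_sub_right_eq_self (fun y : ℝ => ((((σ - p.re : ℝ) : ℂ) + y * I)⁻¹ -
        (((σ - q.re : ℝ) : ℂ) + y * I)⁻¹)) p.im]
      congr 1
      funext y
      simp only [hK]
      congr 2
      · apply Complex.ext <;> simp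
      · apply Complex.ext <;> simp [hqim]
    have hKint' : ∀ σ ∈ Icc α β, σ ≠ p.re → Integrable fun y : ℝ => K (σ + y * I) := by
      intro σ hσ hne
      have h := (integrable_inv_sub_inv (σ - p.re) (σ - q.re) (sub_ne_zero.mpr hne)
        (by rw [hqre]; linarith [hσ.1])).comp_sub_right p.im
      refine h.congr (Eventually.of_forall fun y => ?_)
      simp only [hK]
      congr 2
      · apply Complex.ext <;> simp
      · apply Complex.ext <;> simp [hqim]
    have hKβ : ∫ y : ℝ, K (β + y * I) = 0 := by
      rw [hKint, integral_inv_sub_inv _ _ (by linarith [hp.2]) (by rw [hqre]; linarith),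
        sign_pos (by linarith [hp.2]), sign_pos (by rw [hqre]; linarith)]
      simp
    have hKα : ∫ y : ℝ, K (α + y * I) = -(2 * Real.pi) := by
      rw [hKint, integral_inv_sub_inv _ _ (by linarith [hp.1]) (by rw [hqre]; linarith),
        sign_neg (by linarith [hp.1]), sign_pos (by rw [hqre]; linarith)]
      push_cast
      simp
      ring
    set f₁ : ℂ → ℂ := fun v => f v - r p * K v with hf₁
    -- The singularity at `p` is now removable, and the induction hypothesis applies after filling
    -- it in.
    set f₂ : ℂ → ℂ := Function.update f₁ p (limUnder (𝓝[≠] p) f₁) with hf₂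
    have hf₂_of_ne : ∀ v, v ≠ p → f₂ v = f₁ v := fun v hv => Function.update_of_ne hv _ _
    have hf₁diff : DifferentiableOn ℂ f₁ ((re ⁻¹' Icc α β) \ (insert p S : Finset ℂ)) := by
      intro v hv
      have hvp : v ≠ p := by
        rintro rfl; exact hv.2 (by simp)
      exact (hf v hv).sub ((hKdiff v hvp (hstrip_q v hv.1)).const_mul _).differentiableWithinAt
    have hres₁ : Tendsto (fun v => (v - p) * f₁ v) (𝓝[≠] p) (𝓝 0) := by
      have h1 := hres p (Finset.mem_insert_self _ _)
      have h2 : Tendsto (fun v => r p * (1 - (v - p) * (v - q)⁻¹)) (𝓝[≠] p) (𝓝 (r p)) := by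
        have hc : ContinuousAt (fun v => r p * (1 - (v - p) * (v - q)⁻¹)) p := by
          have : p - q ≠ 0 := sub_ne_zero.mpr (hstrip_q p ⟨hp.1.le, hp.2.le⟩)
          fun_prop (disch := assumption)
        have := hc.tendsto.mono_left (nhdsWithin_le_nhds (s := {p}ᶜ))
        simpa using this
      have h3 := h1.sub h2
      rw [sub_self] at h3
      refine h3.congr' ?_
      filter_upwards [self_mem_nhdsWithin] with v hv
      have : v - p ≠ 0 := sub_ne_zero.mpr hv
      simp only [hf₁, hK]
      field_simp
    have hstripS : (re ⁻¹' Icc α β) \ (S : Set ℂ) ∈ 𝓝 p := by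
      have h1 : re ⁻¹' Ioo α β ∈ 𝓝 p := (isOpen_Ioo.preimage continuous_re).mem_nhds hp
      have h2 : (S : Set ℂ)ᶜ ∈ 𝓝 p := S.finite_toSet.isClosed.isOpen_compl.mem_nhds hpS
      filter_upwards [h1, h2] with v hv1 hv2 using ⟨Ioo_subset_Icc_self hv1, hv2⟩
    have hf₂diff : DifferentiableOn ℂ f₂ ((re ⁻¹' Icc α β) \ S) := by
      refine differentiableOn_update_limUnder_of_isLittleO hstripS ?_ ?_
      · refine hf₁diff.mono fun v hv => ⟨hv.1.1, ?_⟩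
        simp only [Finset.coe_insert, mem_insert_iff, not_or]
        exact ⟨hv.2, hv.1.2⟩
      · rw [Asymptotics.isLittleO_iff_tendsto']
        · have h4 : Tendsto (fun v => (v - p) * f₁ p) (𝓝[≠] p) (𝓝 0) := by
            have hc : Continuous (fun v => (v - p) * f₁ p) := by fun_prop
            have := (hc.tendsto p).mono_left (nhdsWithin_le_nhds (s := {p}ᶜ))
            simpa using this
          have h5 := hres₁.sub h4
          rw [sub_zero] at h5
          refine h5.congr fun v => ?_
          rw [div_inv_eq_mul]
          ring
        · filter_upwards [self_mem_nhdsWithin] with v hv h0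
          exact absurd h0 (inv_ne_zero (sub_ne_zero.mpr hv))
    have hres₂ : ∀ p' ∈ S, Tendsto (fun v => (v - p') * f₂ v) (𝓝[≠] p') (𝓝 (r p')) := by
      intro p' hp'
      have hne : p' ≠ p := by rintro rfl; exact hpS hp'
      have hstrip' := hS p' (Finset.mem_insert_of_mem hp')
      have h1 := hres p' (Finset.mem_insert_of_mem hp')
      have h2 : Tendsto (fun v => (v - p') * (r p * K v)) (𝓝[≠] p') (𝓝 0) := by
        have hc : ContinuousAt (fun v => (v - p') * (r p * K v)) p' :=
          ContinuousAt.mul (by fun_prop) (continuousAt_const.mul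
            (hKdiff p' hne (hstrip_q p' (Ioo_subset_Icc_self hstrip'))).continuousAt)
        have := hc.tendsto.mono_left (nhdsWithin_le_nhds (s := {p'}ᶜ))
        simpa using this
      have h3 := h1.sub h2
      rw [sub_zero] at h3
      refine h3.congr' ?_
      have : ∀ᶠ v in 𝓝[≠] p', v ≠ p := nhdsWithin_le_nhds (isOpen_ne.mem_nhds hne)
      filter_upwards [this] with v hv
      rw [hf₂_of_ne v hv]
      simp only [hf₁]
      ring
    -- The threshold ensures `|v.im - p.im| ≥ |v.im| / 2` and `≥ 1`.
    have hdecay₂ : ∀ v : ℂ, v.re ∈ Icc α β → max T (2 * |p.im| + 2) ≤ |v.im| →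
        ‖f₂ v‖ ≤ (M + ‖r p‖ * (8 * ‖p - q‖)) / (1 + v.im ^ 2) := by
      intro v hv hvim
      have hT : T ≤ |v.im| := (le_max_left _ _).trans hvim
      have hP : 2 * |p.im| + 2 ≤ |v.im| := (le_max_right _ _).trans hvim
      have hvp : v ≠ p := by
        rintro rfl
        linarith [abs_nonneg v.im]
      have hab : |v.im| - |p.im| ≤ |v.im - p.im| := abs_sub_abs_le_abs_sub _ _
      have hhalf : |v.im| / 2 ≤ |v.im - p.im| := by linarith
      have hsq : v.im ^ 2 ≤ 4 * (v.im - p.im) ^ 2 := by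
        rw [← sq_abs v.im, ← sq_abs (v.im - p.im)]
        nlinarith [abs_nonneg v.im]
      have hKv : ‖K v‖ ≤ 8 * ‖p - q‖ / (1 + v.im ^ 2) := by
        have h1 := norm_inv_sub_inv_le (v - p) (v - q) (by simp [hqim])
          (by rw [sub_im]; linarith [abs_nonneg p.im])
        refine h1.trans ?_
        rw [show v - q - (v - p) = p - q by ring, sub_im,
          div_le_div_iff₀ (by positivity) (by positivity)]
        nlinarith [norm_nonneg (p - q)]
      rw [hf₂_of_ne v hvp]
      calc ‖f v - r p * K v‖ ≤ ‖f v‖ + ‖r p‖ * ‖K v‖ := by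
            rw [← norm_mul]; exact norm_sub_le _ _
        _ ≤ M / (1 + v.im ^ 2) + ‖r p‖ * (8 * ‖p - q‖ / (1 + v.im ^ 2)) := by
            gcongr
            exact hdecay v hv hT
        _ = _ := by ring
    have hmain := ih (f := f₂) (fun p' hp' => hS p' (Finset.mem_insert_of_mem hp')) hf₂diff hres₂
      hdecay₂
    have hfint : ∀ σ ∈ Icc α β, (∀ p' ∈ insert p S, p'.re ≠ σ) →
        Integrable fun y : ℝ => f (σ + y * I) := fun σ hσ h =>
      integrable_vertical_of_quadratic_decay hσ (by simpa using h) hf hdecay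
    have hline : ∀ σ ∈ Icc α β, (∀ p' ∈ insert p S, p'.re ≠ σ) → ∫ y : ℝ, f₂ (σ + y * I) =
        (∫ y : ℝ, f (σ + y * I)) - r p * ∫ y : ℝ, K (σ + y * I) := by
      intro σ hσ h
      have hpσ := h p (Finset.mem_insert_self _ _)
      rw [← integral_const_mul, ← integral_sub (hfint σ hσ h)
        ((hKint' σ hσ hpσ.symm).const_mul _)]
      congr 1
      funext y
      rw [hf₂_of_ne _ (by rintro h'; exact hpσ (by rw [← h']; simp))]
    rw [hline β (right_mem_Icc.mpr hαβ) fun p' hp' => (hS p' hp').2.ne,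
      hline α (left_mem_Icc.mpr hαβ) fun p' hp' => (hS p' hp').1.ne', hKα, hKβ] at hmain
    rw [Finset.sum_insert hpS]
    linear_combination hmain

end ContourIntegrals

/-! ### Exponential decay of `Γ` and of the completed zeta function -/

section GammaAndZetaDecay

open MeasureTheory

theorem frequently_punctured_nhds_of_forall_ofReal {P : ℂ → Prop} {x : ℝ}
    (h : ∀ᶠ t : ℝ in 𝓝 x, P t) : ∃ᶠ z in 𝓝[≠] (x : ℂ), P z := by
  have h1 : Tendsto (fun t : ℝ => (t : ℂ)) (𝓝[≠] x) (𝓝[≠] (x : ℂ)) := by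
    refine tendsto_nhdsWithin_iff.mpr ⟨(continuous_ofReal.tendsto x).mono_left nhdsWithin_le_nhds,
      ?_⟩
    filter_upwards [self_mem_nhdsWithin] with t ht
    simpa using ht
  exact h1.frequently (h.filter_mono nhdsWithin_le_nhds).frequently

/-- The Gamma integral with a complex scaling factor in the right half-plane. -/
theorem integral_cpow_mul_cexp_neg_mul {w r : ℂ} (hw : 0 < w.re) (hr : 0 < r.re) :
    ∫ t : ℝ in Ioi 0, (t : ℂ) ^ (w - 1) * cexp (-(r * t)) = (1 / r) ^ w * Gamma w := by
  set U : Set ℂ := {z | 0 < z.re} with hU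
  have hUo : IsOpen U := isOpen_lt continuous_const continuous_re
  have hUc : IsPreconnected U := (convex_halfSpace_re_gt 0).isPreconnected
  have hmeas : ∀ z : ℂ, AEStronglyMeasurable
      (fun t : ℝ => (t : ℂ) ^ (w - 1) * cexp (-(z * t))) (volume.restrict (Ioi 0)) := by
    intro z
    refine ContinuousOn.aestronglyMeasurable ?_ measurableSet_Ioi
    refine ContinuousOn.mul ?_ (by fun_prop)
    intro t ht
    exact (continuousAt_ofReal_cpow_const _ _ (Or.inr (ne_of_gt ht))).continuousWithinAt
  have hf : DifferentiableOn ℂ (fun z : ℂ =>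
      ∫ t : ℝ in Ioi 0, (t : ℂ) ^ (w - 1) * cexp (-(z * t))) U := by
    intro z hz
    have hz2 : 0 < z.re / 2 := half_pos hz
    refine (differentiableAt_integral_of_dominated_ball (r := z.re / 2)
      (bound := fun t => t ^ (w.re - 1) * Real.exp (-(z.re / 2 * t))) hz2 (fun x _ => hmeas x)
      (fun t => by fun_prop) ?_ ?_).differentiableWithinAt
    · filter_upwards [ae_restrict_mem measurableSet_Ioi] with t ht x hx
      rw [mem_Ioi] at ht
      rw [norm_mul, norm_cpow_eq_rpow_re_of_pos ht, norm_exp]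
      have h1 : |(x - z).re| ≤ ‖x - z‖ := abs_re_le_norm _
      rw [mem_ball_iff_norm] at hx
      have h2 : z.re / 2 ≤ x.re := by
        rw [sub_re] at h1
        linarith [(abs_le.mp h1).1]
      simp only [sub_re, one_re, neg_re, mul_re, ofReal_re, ofReal_im, mul_zero, sub_zero]
      gcongr
    -- The integral has a nonzero value, so the integrand must be integrable.
    · have h := Real.integral_rpow_mul_exp_neg_mul_Ioi hw hz2
      by_contra hcon
      rw [integral_undef hcon] at h
      exact absurd h.symm (mul_pos (Real.rpow_pos_of_pos (by positivity) _)
        (Real.Gamma_pos_of_pos hw)).ne'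
  have hg : DifferentiableOn ℂ (fun z : ℂ => (1 / z) ^ w * Gamma w) U := by
    intro z hz
    have hz0 : z ≠ 0 := by rintro rfl; simp [hU] at hz
    have hs : 1 / z ∈ slitPlane := by
      left
      rw [one_div, inv_re]
      exact div_pos hz (normSq_pos.mpr hz0)
    refine DifferentiableAt.differentiableWithinAt ?_
    refine DifferentiableAt.mul_const ?_ _
    exact DifferentiableAt.cpow (by fun_prop (disch := assumption)) (by fun_prop) hs
  refine (hf.analyticOnNhd hUo).eqOn_of_preconnected_of_frequently_eq (hg.analyticOnNhd hUo) hUc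
    (z₀ := ((1 : ℝ) : ℂ)) (by simp [hU]) ?_ hr
  refine frequently_punctured_nhds_of_forall_ofReal ?_
  filter_upwards [eventually_gt_nhds one_pos] with x hx
  exact integral_cpow_mul_exp_neg_mul_Ioi hw hx

/-- Rotating the ray of the Gamma integral by the angle `θ`: with `r = exp(iθ)` the factor `r^(-w)`
has modulus `exp(θ Im w)`, and taking absolute values in the integrand replaces `r` by `cos θ`. -/
theorem norm_Gamma_mul_exp_le {w : ℂ} {θ : ℝ} (hw : 0 < w.re) (hθ : |θ| < Real.pi / 2) :
    ‖Gamma w‖ * Real.exp (θ * w.im) ≤ (1 / Real.cos θ) ^ w.re * Real.Gamma w.re := by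
  have hcos : 0 < Real.cos θ := Real.cos_pos_of_mem_Ioo ⟨by linarith [(abs_lt.mp hθ).1],
    (abs_lt.mp hθ).2⟩
  have hr : (cexp (θ * I)).re = Real.cos θ := exp_ofReal_mul_I_re θ
  have h := integral_cpow_mul_cexp_neg_mul hw (r := cexp (θ * I)) (by rw [hr]; exact hcos)
  have h1 : (1 / cexp (θ * I)) ^ w = cexp (-(θ * I) * w) := by
    rw [one_div, ← Complex.exp_neg, cpow_def_of_ne_zero (Complex.exp_ne_zero _),
      log_exp]
    · simp; linarith [(abs_lt.mp hθ).2, Real.pi_pos]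
    · simp; linarith [(abs_lt.mp hθ).1, Real.pi_pos]
  have h2 : ‖(1 / cexp (θ * I)) ^ w * Gamma w‖ = ‖Gamma w‖ * Real.exp (θ * w.im) := by
    rw [norm_mul, h1, norm_exp, mul_comm]
    simp
  rw [← h2, ← h, ← Real.integral_rpow_mul_exp_neg_mul_Ioi hw hcos]
  refine (norm_integral_le_integral_norm _).trans_eq ?_
  refine setIntegral_congr_fun measurableSet_Ioi fun t ht => ?_
  rw [norm_mul, norm_cpow_eq_rpow_re_of_pos ht, norm_exp]
  simp [exp_ofReal_mul_I_re]

/-- Exponential decay of `Γ` in vertical strips of the right half-plane. -/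
theorem exists_norm_Gamma_le {σ₁ σ₂ θ : ℝ} (hσ : 0 < σ₁) (hθ₀ : 0 ≤ θ) (hθ : θ < Real.pi / 2) :
    ∃ M, 0 ≤ M ∧ ∀ w : ℂ, w.re ∈ Icc σ₁ σ₂ → ‖Gamma w‖ ≤ M * Real.exp (-(θ * |w.im|)) := by
  have hcos : 0 < Real.cos θ := Real.cos_pos_of_mem_Ioo ⟨by linarith [Real.pi_pos], hθ⟩
  have hcont : ContinuousOn (fun σ : ℝ => (1 / Real.cos θ) ^ σ * Real.Gamma σ) (Icc σ₁ σ₂) := by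
    intro σ hs
    have h0 : 0 < σ := hσ.trans_le hs.1
    refine ContinuousAt.continuousWithinAt (ContinuousAt.mul ?_ ?_)
    · exact Real.continuousAt_const_rpow (by positivity)
    · refine (Real.differentiableAt_Gamma fun m => ?_).continuousAt
      have : (0 : ℝ) ≤ m := m.cast_nonneg
      linarith
  obtain ⟨M, hM⟩ := isCompact_Icc.exists_bound_of_continuousOn hcont
  refine ⟨max M 0, le_max_right _ _, fun w hw => ?_⟩
  have h0 : 0 < w.re := hσ.trans_le hw.1
  have hb := (le_abs_self _).trans (hM _ hw)
  have key : ‖Gamma w‖ * Real.exp (θ * |w.im|) ≤ M := by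
    rcases le_total 0 w.im with h | h
    · rw [abs_of_nonneg h]
      exact (norm_Gamma_mul_exp_le h0 (by rwa [abs_of_nonneg hθ₀])).trans hb
    · have := norm_Gamma_mul_exp_le (θ := -θ) h0 (by rwa [abs_neg, abs_of_nonneg hθ₀])
      rw [Real.cos_neg] at this
      rw [abs_of_nonpos h, mul_neg, ← neg_mul]
      exact this.trans hb
  rw [Real.exp_neg, ← div_eq_mul_inv, le_div_iff₀ (Real.exp_pos _)]
  exact key.trans (le_max_left _ _)

/-- Each intermediate power of `t` is at most the sum of the two extreme ones. -/
theorem exists_norm_mellin_le {f : ℝ → ℂ} {σ₁ σ₂ : ℝ} (h₁ : MellinConvergent f σ₁)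
    (h₂ : MellinConvergent f σ₂) :
    ∃ B, 0 ≤ B ∧ ∀ w : ℂ, w.re ∈ Icc σ₁ σ₂ → ‖mellin f w‖ ≤ B := by
  have hint := h₁.norm.add h₂.norm
  refine ⟨_, integral_nonneg fun t => ?_, fun w hw => norm_integral_le_of_norm_le hint ?_⟩
  · simp only [Pi.add_apply, Pi.zero_apply]; positivity
  · filter_upwards [ae_restrict_mem measurableSet_Ioi] with t ht
    rw [mem_Ioi] at ht
    simp only [Pi.add_apply, norm_smul, norm_cpow_eq_rpow_re_of_pos ht, sub_re, ofReal_re, one_re]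
    rw [← add_mul]
    gcongr
    rcases le_total 1 t with h | h
    · have := Real.rpow_le_rpow_of_exponent_le h (sub_le_sub_right hw.2 1)
      linarith [Real.rpow_nonneg ht.le (σ₁ - 1)]
    · have := Real.rpow_le_rpow_of_exponent_ge ht h (sub_le_sub_right hw.1 1)
      linarith [Real.rpow_nonneg ht.le (σ₂ - 1)]

theorem exists_norm_completedRiemannZeta₀_le (σ₁ σ₂ : ℝ) :
    ∃ B, 0 ≤ B ∧ ∀ u : ℂ, u.re ∈ Icc σ₁ σ₂ → ‖completedRiemannZeta₀ u‖ ≤ B := by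
  have hc : ∀ s : ℂ, MellinConvergent (HurwitzZeta.hurwitzEvenFEPair 0).f_modif s := fun s =>
    ((HurwitzZeta.hurwitzEvenFEPair 0).isStrongFEPair_toStrongFEPair.hasMellin s).1
  obtain ⟨B, hB₀, hB⟩ := exists_norm_mellin_le (hc ((σ₁ / 2 : ℝ) : ℂ)) (hc ((σ₂ / 2 : ℝ) : ℂ))
  refine ⟨B, hB₀, fun u hu => ?_⟩
  have h2 : (u / 2).re = u.re / 2 := by simp
  have h := hB (u / 2) (by rw [h2]; exact ⟨by linarith [hu.1], by linarith [hu.2]⟩)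
  -- By definition `completedRiemannZeta₀` is half the Mellin transform, at `u / 2`, of a modified
  -- theta kernel; this transform converges everywhere.
  change ‖mellin (HurwitzZeta.hurwitzEvenFEPair 0).f_modif (u / 2) / 2‖ ≤ B
  rw [norm_div]
  norm_num
  linarith

theorem norm_riemannZeta_le {u : ℂ} (hu : 1 < u.re) :
    ‖riemannZeta u‖ ≤ ∑' n : ℕ, 1 / ((n : ℝ) + 1) ^ u.re := by
  rw [zeta_eq_tsum_one_div_nat_add_one_cpow hu]
  have hterm : ∀ n : ℕ, ‖1 / ((n : ℂ) + 1) ^ u‖ = 1 / ((n : ℝ) + 1) ^ u.re := by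
    intro n
    have : ((n : ℂ) + 1) = (((n : ℝ) + 1 : ℝ) : ℂ) := by push_cast; rfl
    rw [norm_div, norm_one, this, norm_cpow_eq_rpow_re_of_pos (by positivity)]
  have hs : Summable fun n : ℕ => 1 / ((n : ℝ) + 1) ^ u.re := by
    have := (summable_nat_add_iff 1).mpr (Real.summable_one_div_nat_rpow.mpr hu)
    simpa using this
  refine (norm_tsum_le_tsum_norm ?_).trans_eq (tsum_congr hterm)
  simpa only [hterm] using hs

/-- The zeta factor is bounded here; the decay is that of `Γ(u / 2)`, whence `π/4` instead of `π/2`.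
-/
theorem exists_norm_completedRiemannZeta_vertical_line_le {σ θ : ℝ} (hσ : 1 < σ) (hθ₀ : 0 ≤ θ)
    (hθ : θ < Real.pi / 4) :
    ∃ M, 0 ≤ M ∧ ∀ u : ℂ, u.re = σ → ‖completedRiemannZeta u‖ ≤ M * Real.exp (-(θ * |u.im|)) := by
  obtain ⟨M, hM₀, hM⟩ := exists_norm_Gamma_le (σ₁ := σ / 2) (σ₂ := σ / 2) (θ := 2 * θ)
    (by linarith) (by linarith) (by linarith)
  refine ⟨Real.pi ^ (-σ / 2) * M * ∑' n : ℕ, 1 / ((n : ℝ) + 1) ^ σ, by positivity,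
    fun u hu => ?_⟩
  rw [completedRiemannZeta_eq_mul, norm_mul, norm_mul]
  · have h1 : ‖(Real.pi : ℂ) ^ (-u / 2)‖ = Real.pi ^ (-σ / 2) := by
      rw [norm_cpow_eq_rpow_re_of_pos Real.pi_pos]
      simp [hu]
    have h2 := hM (u / 2) (by simp [hu])
    have h3 : 2 * θ * |(u / 2).im| = θ * |u.im| := by
      have : (u / 2).im = u.im / 2 := by simp
      rw [this, abs_div, abs_two]; ring
    rw [h3] at h2
    have h4 := norm_riemannZeta_le (u := u) (by rw [hu]; exact hσ)
    rw [hu] at h4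
    rw [h1]
    calc _ ≤ Real.pi ^ (-σ / 2) * (M * Real.exp (-(θ * |u.im|))) *
          ∑' n : ℕ, 1 / ((n : ℝ) + 1) ^ σ := by gcongr
      _ = _ := by ring
  · rintro k rfl
    have : (-(2 * (k : ℂ))).re = -(2 * k) := by simp
    rw [this] at hu
    have : (0 : ℝ) ≤ k := k.cast_nonneg
    linarith

theorem sq_add_le_mul_exp {β ε y : ℝ} (hε : 0 < ε) (hβ : 0 ≤ β) (hy : 0 ≤ y) :
    (β + y) ^ 2 ≤ 4 / ε ^ 2 * Real.exp (ε * β) * Real.exp (ε * y) := by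
  have h1 : ε / 2 * (β + y) ≤ Real.exp (ε / 2 * (β + y)) := by
    linarith [Real.add_one_le_exp (ε / 2 * (β + y))]
  have h2 : (ε / 2 * (β + y)) ^ 2 ≤ Real.exp (ε / 2 * (β + y)) ^ 2 := by gcongr
  rw [← Real.exp_nat_mul] at h2
  rw [mul_assoc, ← Real.exp_add, div_mul_eq_mul_div, le_div_iff₀ (by positivity)]
  have h3 : ((2 : ℕ) : ℝ) * (ε / 2 * (β + y)) = ε * β + ε * y := by push_cast; ring
  rw [h3] at h2
  nlinarith

theorem mul_completedRiemannZeta_eq {u : ℂ} (h0 : u ≠ 0) (h1 : u ≠ 1) :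
    u * (u - 1) * completedRiemannZeta u = u * (u - 1) * completedRiemannZeta₀ u + 1 := by
  rw [completedRiemannZeta_eq]
  have h2 : 1 - u ≠ 0 := sub_ne_zero.mpr h1.symm
  field_simp
  ring

/-- Exponential decay of the completed zeta function in vertical strips. -/
theorem exists_norm_completedRiemannZeta_le {β κ : ℝ} (hβ : 1 < β) (hκ₀ : 0 ≤ κ)
    (hκ : κ < Real.pi / 4) :
    ∃ M, 0 ≤ M ∧ ∀ u : ℂ, u.re ∈ Icc (1 - β) β → 1 ≤ |u.im| →
      ‖completedRiemannZeta u‖ ≤ M * Real.exp (-(κ * |u.im|)) := by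
  obtain ⟨θ, hκθ, hθ⟩ := exists_between hκ
  obtain ⟨M₁, hM₁₀, hM₁⟩ := exists_norm_completedRiemannZeta_vertical_line_le hβ
    (hκ₀.trans hκθ.le) hθ
  obtain ⟨B, hB₀, hB⟩ := exists_norm_completedRiemannZeta₀_le (1 - β) β
  -- This is `u(u - 1)Λ(u)` without its removable singularities: entire and invariant under `u ↦ 1 -
  -- u`, so a bound on the right edge transfers to the left one. The loss from `θ` to `κ` absorbs
  -- the polynomial factor.
  set ξ : ℂ → ℂ := fun u => u * (u - 1) * completedRiemannZeta₀ u + 1 with hξ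
  have hξdiff : Differentiable ℂ ξ := by
    have := differentiable_completedZeta₀
    fun_prop
  set ε := θ - κ with hε
  have hε₀ : 0 < ε := sub_pos.mpr hκθ
  set A : ℝ := 4 / ε ^ 2 * Real.exp (ε * β) * M₁ with hA
  have hpoly : ∀ u : ℂ, u.re ∈ Icc (1 - β) β → ‖u * (u - 1)‖ ≤ (β + |u.im|) ^ 2 := by
    intro u hu
    rw [norm_mul, sq]
    have h1 : ‖u‖ ≤ |u.re| + |u.im| := norm_le_abs_re_add_abs_im u
    have h2 : ‖u - 1‖ ≤ |u.re - 1| + |u.im| := by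
      simpa using norm_le_abs_re_add_abs_im (u - 1)
    have h3 : |u.re| ≤ β := abs_le.mpr ⟨by linarith [hu.1], hu.2⟩
    have h4 : |u.re - 1| ≤ β := abs_le.mpr ⟨by linarith [hu.1], by linarith [hu.2]⟩
    gcongr <;> linarith
  have hright : ∀ u : ℂ, u.re = β → ‖ξ u‖ ≤ A * Real.exp (-(κ * |u.im|)) := by
    intro u hu
    have h0 : u ≠ 0 := by rintro rfl; simp at hu; linarith
    have h1 : u ≠ 1 := by rintro rfl; simp at hu; linarith
    have h2 := hM₁ u hu
    have h3 := hpoly u (by rw [hu]; exact ⟨by linarith, le_rfl⟩)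
    have h4 := sq_add_le_mul_exp (β := β) hε₀ (by linarith) (abs_nonneg u.im)
    simp only [hξ]
    rw [← mul_completedRiemannZeta_eq h0 h1, norm_mul]
    calc _ ≤ (4 / ε ^ 2 * Real.exp (ε * β) * Real.exp (ε * |u.im|)) *
          (M₁ * Real.exp (-(θ * |u.im|))) := by
            gcongr
            exact h3.trans h4
      _ = A * (Real.exp (ε * |u.im|) * Real.exp (-(θ * |u.im|))) := by rw [hA]; ring
      _ = _ := by rw [← Real.exp_add]; congr 2; rw [hε]; ring
  have hξsymm : ∀ u, ξ (1 - u) = ξ u := by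
    intro u
    simp only [hξ, completedRiemannZeta₀_one_sub]
    ring
  have hleft : ∀ u : ℂ, u.re = 1 - β → ‖ξ u‖ ≤ A * Real.exp (-(κ * |u.im|)) := by
    intro u hu
    have := hright (1 - u) (by simp [hu])
    rw [hξsymm] at this
    simpa using this
  have hgrow : ∀ u : ℂ, u.re ∈ Icc (1 - β) β →
      ‖ξ u‖ ≤ (4 * Real.exp β * B + 1) * Real.exp |u.im| := by
    intro u hu
    have h3 := hpoly u hu
    have h4 := sq_add_le_mul_exp (β := β) one_pos (by linarith) (abs_nonneg u.im)
    norm_num at h4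
    have h5 : 1 ≤ Real.exp |u.im| := Real.one_le_exp (abs_nonneg _)
    calc ‖ξ u‖ ≤ ‖u * (u - 1)‖ * ‖completedRiemannZeta₀ u‖ + 1 := by
          rw [← norm_mul]; simpa [hξ] using norm_add_le (u * (u - 1) * completedRiemannZeta₀ u) 1
      _ ≤ (4 * Real.exp β * Real.exp |u.im|) * B + Real.exp |u.im| := by
          gcongr
          · exact h3.trans h4
          · exact hB u hu
      _ = _ := by ring
  -- Multiplying by `exp(-ieu)` turns decay on the edges into boundedness; `e = κ` and `e = -κ`
  -- serve the upper and the lower half of the strip.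
  have hPL : ∀ e : ℝ, |e| = κ → ∀ u : ℂ, u.re ∈ Icc (1 - β) β →
      ‖ξ u‖ * Real.exp (e * u.im) ≤ A := by
    intro e he u hu
    have hnorm : ∀ u : ℂ, ‖ξ u * cexp (-(e * I) * u)‖ = ‖ξ u‖ * Real.exp (e * u.im) := by
      intro u
      rw [norm_mul, norm_exp]
      simp
    have hexp : ∀ u : ℂ, Real.exp (e * u.im) ≤ Real.exp (κ * |u.im|) := by
      intro u
      rw [← he, ← abs_mul]
      exact Real.exp_le_exp.mpr (le_abs_self _)
    have hbdry : ∀ u : ℂ, ‖ξ u‖ ≤ A * Real.exp (-(κ * |u.im|)) →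
        ‖ξ u * cexp (-(e * I) * u)‖ ≤ A := by
      intro u h
      rw [hnorm]
      calc _ ≤ A * Real.exp (-(κ * |u.im|)) * Real.exp (κ * |u.im|) := by
            exact mul_le_mul h (hexp u) (Real.exp_pos _).le (by positivity)
        _ = A := by rw [mul_assoc, ← Real.exp_add]; simp
    rw [← hnorm]
    refine PhragmenLindelof.vertical_strip (a := 1 - β) (b := β)
      (f := fun u => ξ u * cexp (-(e * I) * u)) ?_ ?_ (fun z hz => hbdry z (hleft z hz))
      (fun z hz => hbdry z (hright z hz)) hu.1 hu.2
    · exact (hξdiff.mul (by fun_prop)).diffContOnCl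
    -- Any `c` below `π` over the width would do. Growth is only of order `exp((1 + κ) |Im z|)`, and
    -- `c |Im z| ≤ exp(c |Im z|)` brings it to the double exponential form required.
    · set c : ℝ := Real.pi / (β - (1 - β)) / 2 with hc
      have hc₀ : 0 < Real.pi / (β - (1 - β)) := div_pos Real.pi_pos (by linarith)
      have hcpos : 0 < c := half_pos hc₀
      refine ⟨c, half_lt_self hc₀, (1 + κ) / c, ?_⟩
      refine Asymptotics.IsBigO.of_bound (4 * Real.exp β * B + 1) ?_
      refine eventually_inf_principal.mpr (Eventually.of_forall fun z hz => ?_)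
      rw [hnorm, Real.norm_of_nonneg (Real.exp_pos _).le]
      have h1 : c * |z.im| ≤ Real.exp (c * |z.im|) := by
        linarith [Real.add_one_le_exp (c * |z.im|)]
      calc _ ≤ (4 * Real.exp β * B + 1) * Real.exp |z.im| * Real.exp (κ * |z.im|) := by
            exact mul_le_mul (hgrow z (Ioo_subset_Icc_self hz)) (hexp z) (Real.exp_pos _).le
              (by positivity)
        _ = (4 * Real.exp β * B + 1) * Real.exp ((1 + κ) / c * (c * |z.im|)) := by
            rw [mul_assoc, ← Real.exp_add]
            congr 2
            field_simp
        _ ≤ _ := by gcongr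
  refine ⟨A, by positivity, fun u hu him => ?_⟩
  have h0 : u ≠ 0 := by rintro rfl; simp at him; linarith
  have h1 : u ≠ 1 := by rintro rfl; simp at him; linarith
  have hξu : ‖ξ u‖ ≤ A * Real.exp (-(κ * |u.im|)) := by
    rw [Real.exp_neg, ← div_eq_mul_inv, le_div_iff₀ (Real.exp_pos _)]
    rcases le_total 0 u.im with h | h
    · rw [abs_of_nonneg h]
      exact hPL κ (abs_of_nonneg hκ₀) u hu
    · rw [abs_of_nonpos h, mul_neg, ← neg_mul]
      exact hPL (-κ) (by rw [abs_neg, abs_of_nonneg hκ₀]) u hu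
  refine le_trans ?_ hξu
  simp only [hξ]
  rw [← mul_completedRiemannZeta_eq h0 h1, norm_mul, norm_mul]
  have h2 : 1 ≤ ‖u‖ := him.trans (abs_im_le_norm u)
  have h3 : 1 ≤ ‖u - 1‖ := him.trans (by simpa using abs_im_le_norm (u - 1))
  nlinarith [norm_nonneg (completedRiemannZeta u), mul_le_mul h2 h3 zero_le_one (norm_nonneg u)]

end GammaAndZetaDecay

/-! ### Mellin inversion through Fourier inversion -/

section MellinInversion

open MeasureTheory
open scoped FourierTransform

theorem MellinConvergent.integrable_comp_exp_neg {f : ℝ → ℂ} {σ : ℝ} (hf : MellinConvergent f σ) :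
    Integrable fun u : ℝ => Real.exp (-σ * u) • f (Real.exp (-u)) := by
  have himage : (fun u : ℝ => Real.exp (-u)) '' univ = Ioi 0 := by
    rw [image_univ]
    ext x
    refine ⟨fun ⟨u, hu⟩ => hu ▸ Real.exp_pos _, fun hx => ⟨-Real.log x, ?_⟩⟩
    simpa using Real.exp_log hx
  have hderiv : ∀ u ∈ (univ : Set ℝ),
      HasDerivWithinAt (fun u : ℝ => Real.exp (-u)) (-Real.exp (-u)) univ u := fun u _ => by
    simpa [Function.comp_def] using
      ((Real.hasDerivAt_exp (-u)).comp u (hasDerivAt_neg u)).hasDerivWithinAt (s := univ)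
  have hinj : InjOn (fun u : ℝ => Real.exp (-u)) univ := fun u _ v _ h => by
    simpa using h
  rw [MellinConvergent, ← himage, integrableOn_image_iff_integrableOn_abs_deriv_smul
    MeasurableSet.univ hderiv hinj, integrableOn_univ] at hf
  refine hf.congr (Eventually.of_forall fun u => ?_)
  simp only [abs_neg, Real.abs_exp, ← Complex.ofReal_one, ← Complex.ofReal_sub]
  rw [← ofReal_cpow (Real.exp_pos _).le, real_smul, real_smul, smul_eq_mul, ← mul_assoc,
    ← ofReal_mul, ← Real.exp_mul, ← Real.exp_add]
  congr 3
  ring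

/-- The Mellin transform is a left inverse of the inverse Mellin transform. -/
theorem mellin_mellinInv_eq {F : ℂ → ℂ} {w : ℂ} (hcont : Continuous fun y : ℝ => F (w.re + y * I))
    (hF : VerticalIntegrable F w.re) (hconv : MellinConvergent (mellinInv w.re F) w.re) :
    mellin (mellinInv w.re F) w = F w := by
  -- With frequency scaled by `2π`, the inverse Mellin transform in the variable `x = exp(-u)`
  -- becomes `𝓕⁻ G`. Its integrability is the assumed Mellin convergence and passes to the
  -- reflection `𝓕 G`, as Fourier inversion demands.
  set G : ℝ → ℂ := fun y => F (w.re + 2 * Real.pi * y * I) with hG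
  have h2π : 2 * Real.pi ≠ 0 := by positivity
  have hGeq : G = fun y : ℝ => F (w.re + ((2 * Real.pi * y : ℝ) : ℂ) * I) := by
    funext y; simp [hG]
  have hGcont : Continuous G := by
    rw [hGeq]; exact hcont.comp (by fun_prop : Continuous fun y : ℝ => 2 * Real.pi * y)
  have hGint : Integrable G := by
    rw [hGeq]; exact Integrable.comp_mul_left' hF h2π
  have hinv : (fun u : ℝ => Real.exp (-w.re * u) • mellinInv w.re F (Real.exp (-u))) = 𝓕⁻ G := by
    funext u
    rw [mellinInv_eq_fourierInv _ _ (Real.exp_pos _), Real.log_exp, neg_neg, real_smul,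
      smul_eq_mul, ← mul_assoc]
    have h1 : ((Real.exp (-u) : ℝ) : ℂ) ^ (-(w.re : ℂ)) = ((Real.exp (w.re * u) : ℝ) : ℂ) := by
      rw [← ofReal_neg, ← ofReal_cpow (Real.exp_pos _).le, ← Real.exp_mul]
      congr 2; ring
    rw [h1, ← ofReal_mul, ← Real.exp_add]
    simp [hG]
  have hFG : Integrable (𝓕 G) := by
    have h1 : Integrable (𝓕⁻ G) := hinv ▸ hconv.integrable_comp_exp_neg
    have h2 : 𝓕 G = fun v => (𝓕⁻ G) (-v) := by
      funext v
      rw [Real.fourierInv_eq_fourier_neg, neg_neg]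
    rw [h2]
    exact h1.comp_neg
  rw [mellin_eq_fourier, hinv, hGcont.fourier_fourierInv_eq hGint hFG]
  simp only [hG]
  push_cast
  rw [mul_div_cancel₀ _ (by exact_mod_cast h2π), re_add_im]

end MellinInversion

/-! ### Existence and uniqueness of `h` -/

section MellinKernel

open MeasureTheory

/-- An odd function on the strip `|Re z| < a` whose only singularity is a simple pole at the
origin with residue one, of exponential type `b / 2` in the vertical direction. -/
structure IsOddPolarKernel (a b C : ℝ) (g : ℂ → ℂ) : Prop where
  lt_pi_div_two : b < Real.pi / 2
  odd : ∀ z : ℂ, |z.re| < a → z ≠ 0 → g (-z) = -g z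
  differentiableOn : DifferentiableOn ℂ g {z : ℂ | |z.re| < a ∧ z ≠ 0}
  residue : Tendsto (fun z => z * g z) (𝓝[≠] 0) (𝓝 1)
  norm_lt : ∀ z : ℂ, |z.re| < a → 1 < |z.im| → ‖g z‖ < C * Real.exp (b * |z.im| / 2)

/-- The abscissae `c` admissible for the inverse Mellin integral with parameter `s`. -/
structure IsAdmissible (a : ℝ) (s : ℂ) (c : ℝ) : Prop where
  pos : 0 < c
  re_lt : s.re < 2 * c
  lt_add_re : 2 * c < a + s.re

/-- The integrand `Γ(w) g(2w - s) x ^ (-w)` with `x = exp l`. -/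
def mellinKernel (g : ℂ → ℂ) (s l w : ℂ) : ℂ := Gamma w * g (2 * w - s) * cexp (-(w * l))

/-- The inverse Mellin integral of `Γ(w) g(2w - s)` along `Re w = c`, at `x = exp l`. -/
def mellinKernelIntegral (g : ℂ → ℂ) (c : ℝ) (s l : ℂ) : ℂ :=
  1 / (2 * Real.pi) * ∫ y : ℝ, mellinKernel g s l (c + y * I)

theorem exp_neg_mul_abs_le {ε : ℝ} (hε : 0 < ε) (y : ℝ) :
    Real.exp (-(ε * |y|)) ≤ (4 / ε ^ 2 * Real.exp ε) / (1 + y ^ 2) := by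
  have h := sq_add_le_mul_exp (β := 1) hε zero_le_one (abs_nonneg y)
  rw [mul_one] at h
  rw [Real.exp_neg, ← one_div, div_le_div_iff₀ (Real.exp_pos _) (by positivity)]
  nlinarith [abs_nonneg y, sq_abs y]

theorem integrable_exp_neg_mul_abs {ε : ℝ} (hε : 0 < ε) :
    Integrable fun y : ℝ => Real.exp (-(ε * |y|)) := by
  refine (integrable_inv_one_add_sq.const_mul (4 / ε ^ 2 * Real.exp ε)).mono'
    (by fun_prop : Continuous fun y : ℝ => Real.exp (-(ε * |y|))).aestronglyMeasurable
    (Eventually.of_forall fun y => ?_)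
  rw [Real.norm_of_nonneg (Real.exp_pos _).le, ← div_eq_mul_inv]
  exact exp_neg_mul_abs_le hε y

variable {a b C : ℝ} {g : ℂ → ℂ}

theorem IsOddPolarKernel.differentiableAt (hg : IsOddPolarKernel a b C g) {z : ℂ} (hz : |z.re| < a)
    (hz0 : z ≠ 0) : DifferentiableAt ℂ g z := by
  refine hg.differentiableOn.differentiableAt (IsOpen.mem_nhds ?_ ⟨hz, hz0⟩)
  exact (isOpen_lt continuous_re.abs continuous_const).inter isOpen_ne

/-- To the right of the pole, compactness extends the growth bound to `|Im v| ≤ 1`. -/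
theorem IsOddPolarKernel.exists_norm_le (hg : IsOddPolarKernel a b C g) {α β : ℝ} (hα : 0 < α)
    (hβ : β < a) :
    ∃ M, 0 ≤ M ∧ ∀ v : ℂ, v.re ∈ Icc α β → ‖g v‖ ≤ M * Real.exp (b * |v.im| / 2) := by
  have hcomp : IsCompact (Icc α β ×ℂ Icc (-1) 1) := isCompact_Icc.reProdIm isCompact_Icc
  have hcont : ContinuousOn (fun v : ℂ => g v * cexp ((-(b * |v.im| / 2) : ℝ)))
      (Icc α β ×ℂ Icc (-1) 1) := by
    refine ContinuousOn.mul ?_ (by fun_prop)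
    intro v hv
    have hre : α ≤ v.re ∧ v.re ≤ β := hv.1
    refine (hg.differentiableAt ?_ ?_).continuousAt.continuousWithinAt
    · rw [abs_of_pos (by linarith)]; linarith
    · rintro rfl; simp at hre; linarith
  obtain ⟨M, hM⟩ := hcomp.exists_bound_of_continuousOn hcont
  refine ⟨max M (max C 0), by positivity, fun v hv => ?_⟩
  rcases le_or_gt |v.im| 1 with h | h
  · have h1 := hM v ⟨hv, abs_le.mp h⟩
    rw [norm_mul, norm_exp, ofReal_re, Real.exp_neg, ← div_eq_mul_inv,
      div_le_iff₀ (Real.exp_pos _)] at h1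
    refine h1.trans ?_
    gcongr
    exact le_max_left _ _
  · refine (hg.norm_lt v ?_ h).le.trans ?_
    · rw [abs_of_pos (by linarith [hv.1])]; linarith [hv.2]
    · gcongr
      exact (le_max_left _ _).trans (le_max_right _ _)

/-- The sign of `b` is arbitrary, hence `|b|` in the error term. -/
theorem mul_abs_two_mul_sub_le (b y t : ℝ) : b * |2 * y - t| / 2 ≤ b * |y| + |b| * |t| / 2 := by
  have h1 : |(|2 * y - t| - |2 * y|)| ≤ |t| := by
    have := abs_abs_sub_abs_le (2 * y - t) (2 * y)
    simpa using this
  rw [abs_mul 2 y, abs_two] at h1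
  have h2 : b * (|2 * y - t| - 2 * |y|) ≤ |b| * |t| :=
    (le_abs_self _).trans (by rw [abs_mul]; gcongr)
  linarith

/-- The integrand decays exponentially on vertical lines, locally uniformly in the parameters. -/
theorem IsOddPolarKernel.exists_norm_mellinKernel_le (hg : IsOddPolarKernel a b C g)
    {p q t c₁ c₂ φ : ℝ} (hc : 0 < c₁) (hq : q < 2 * c₁) (hp : 2 * c₂ < a + p)
    (hφ : φ < Real.pi / 2 - b) :
    ∃ M ε, 0 ≤ M ∧ 0 < ε ∧ ∀ s l w : ℂ, s.re ∈ Icc p q → |s.im| ≤ t → w.re ∈ Icc c₁ c₂ →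
      |l.im| ≤ φ →
      ‖mellinKernel g s l w‖ ≤ M * Real.exp (-(w.re * l.re)) * Real.exp (-(ε * |w.im|)) := by
  -- Along the line `Γ` decays at rate `θ`, `g(2w - s)` grows at rate `b` and the exponential at
  -- rate `φ`; the surplus `θ - b - φ` is the final `ε`. The maximum with `0` meets the sign
  -- condition on the rate of `Γ`.
  obtain ⟨θ, hθ₁, hθ₂⟩ := exists_between (show max 0 (b + φ) < Real.pi / 2 from
    max_lt (by linarith [Real.pi_pos]) (by linarith))
  have hθ₀ : 0 ≤ θ := (le_max_left _ _).trans hθ₁.le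
  have hθφ : b + φ < θ := (le_max_right _ _).trans_lt hθ₁
  obtain ⟨M₁, hM₁₀, hM₁⟩ := exists_norm_Gamma_le (σ₂ := c₂) hc hθ₀ hθ₂
  obtain ⟨M₂, hM₂₀, hM₂⟩ := hg.exists_norm_le (α := 2 * c₁ - q) (β := 2 * c₂ - p) (by linarith)
    (by linarith)
  refine ⟨M₁ * M₂ * Real.exp (|b| * t / 2), θ - b - φ, by positivity, by linarith,
    fun s l w hs ht hw hl => ?_⟩
  have h1 := hM₁ w hw
  have h2 := hM₂ (2 * w - s) (by
    simp only [sub_re, mul_re, re_ofNat, im_ofNat, zero_mul, sub_zero]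
    exact ⟨by linarith [hs.2, hw.1], by linarith [hs.1, hw.2]⟩)
  have h3 : (2 * w - s).im = 2 * w.im - s.im := by simp
  rw [h3] at h2
  have h4 : ‖cexp (-(w * l))‖ ≤ Real.exp (-(w.re * l.re) + φ * |w.im|) := by
    rw [norm_exp]
    gcongr
    have : w.im * l.im ≤ φ * |w.im| := by
      refine (le_abs_self _).trans ?_
      rw [abs_mul, mul_comm]
      gcongr
    simp only [neg_re, mul_re]
    linarith
  have h5 := mul_abs_two_mul_sub_le b w.im s.im
  have h6 : |b| * |s.im| / 2 ≤ |b| * t / 2 := by gcongr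
  rw [mellinKernel, norm_mul, norm_mul]
  calc _ ≤ (M₁ * Real.exp (-(θ * |w.im|))) *
        (M₂ * Real.exp (b * |w.im| + |b| * t / 2)) *
        Real.exp (-(w.re * l.re) + φ * |w.im|) := by
          gcongr
          refine h2.trans ?_
          gcongr
          linarith
    _ = M₁ * M₂ * (Real.exp (-(θ * |w.im|)) * Real.exp (b * |w.im| + |b| * t / 2) *
        Real.exp (-(w.re * l.re) + φ * |w.im|)) := by ring
    _ = M₁ * M₂ * (Real.exp (|b| * t / 2) * Real.exp (-(w.re * l.re)) *
        Real.exp (-((θ - b - φ) * |w.im|))) := by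
          simp only [← Real.exp_add]
          congr 2
          ring
    _ = _ := by ring

theorem IsOddPolarKernel.differentiableAt_mellinKernel (hg : IsOddPolarKernel a b C g) {s l w : ℂ}
    (hw : IsAdmissible a s w.re) :
    DifferentiableAt ℂ (fun p : ℂ × ℂ × ℂ => mellinKernel g p.1 p.2.1 p.2.2) (s, l, w) := by
  have hre : (2 * w - s).re = 2 * w.re - s.re := by simp
  have h1 : DifferentiableAt ℂ Gamma w := by
    refine differentiableAt_Gamma _ fun m => ?_
    rintro rfl
    have := hw.pos
    simp at this
    linarith [(m.cast_nonneg : (0 : ℝ) ≤ m)]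
  have h2 : DifferentiableAt ℂ g (2 * w - s) := by
    refine hg.differentiableAt ?_ fun h => ?_
    · rw [hre, abs_of_pos (by linarith [hw.re_lt])]; linarith [hw.lt_add_re]
    · rw [h] at hre; simp at hre; linarith [hw.re_lt]
  unfold mellinKernel
  refine (DifferentiableAt.mul ?_ ?_).mul (by fun_prop)
  · exact DifferentiableAt.comp (s, l, w) (g := Gamma) (f := fun p : ℂ × ℂ × ℂ => p.2.2) h1
      (by fun_prop)
  · exact DifferentiableAt.comp (s, l, w) (g := g) (f := fun p : ℂ × ℂ × ℂ => 2 * p.2.2 - p.1) h2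
      (by fun_prop)

theorem IsOddPolarKernel.differentiableAt_mellinKernel_right (hg : IsOddPolarKernel a b C g)
    {s l w : ℂ} (hw : IsAdmissible a s w.re) : DifferentiableAt ℂ (mellinKernel g s l) w :=
  (hg.differentiableAt_mellinKernel hw).comp w (f := fun w => (s, l, w)) (by fun_prop)

theorem IsOddPolarKernel.continuous_mellinKernel_vertical (hg : IsOddPolarKernel a b C g) {s l : ℂ}
    {c : ℝ} (hc : IsAdmissible a s c) :
    Continuous fun y : ℝ => mellinKernel g s l (c + y * I) := by
  refine continuous_iff_continuousAt.mpr fun y => ?_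
  exact ContinuousAt.comp (f := fun y : ℝ => (c : ℂ) + y * I)
    (hg.differentiableAt_mellinKernel_right (by simpa using hc)).continuousAt (by fun_prop)

theorem IsOddPolarKernel.integrable_mellinKernel (hg : IsOddPolarKernel a b C g) {s l : ℂ} {c : ℝ}
    (hc : IsAdmissible a s c) (hl : |l.im| < Real.pi / 2 - b) :
    Integrable fun y : ℝ => mellinKernel g s l (c + y * I) := by
  obtain ⟨M, ε, _, hε, hb⟩ := hg.exists_norm_mellinKernel_le (t := |s.im|) (c₂ := c) hc.pos
    hc.re_lt hc.lt_add_re hl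
  refine ((integrable_exp_neg_mul_abs hε).const_mul (M * Real.exp (-(c * l.re)))).mono'
    (hg.continuous_mellinKernel_vertical hc).aestronglyMeasurable
    (Eventually.of_forall fun y => ?_)
  simpa using hb s l (c + y * I) ⟨le_rfl, le_rfl⟩ le_rfl (by simp) le_rfl

/-- The line can be moved because no pole of `Γ(w)` or `g(2w - s)` lies between admissible
abscissae. -/
theorem IsOddPolarKernel.mellinKernelIntegral_eq_of_le (hg : IsOddPolarKernel a b C g) {s l : ℂ}
    {c c' : ℝ} (hc : IsAdmissible a s c) (hc' : IsAdmissible a s c') (hcc' : c ≤ c')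
    (hl : |l.im| < Real.pi / 2 - b) :
    mellinKernelIntegral g c s l = mellinKernelIntegral g c' s l := by
  obtain ⟨M, ε, hM, hε, hb⟩ := hg.exists_norm_mellinKernel_le (t := |s.im|) (c₂ := c') hc.pos
    hc.re_lt hc'.lt_add_re hl
  unfold mellinKernelIntegral
  congr 1
  refine (integral_vertical_eq_of_differentiableOn (T := 0)
    (M := M * Real.exp (c' * |l.re|) * (4 / ε ^ 2 * Real.exp ε)) hcc' ?_ ?_).symm
  · intro w hw
    exact (hg.differentiableAt_mellinKernel_right ⟨hc.pos.trans_le hw.1,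
      by linarith [hc.re_lt, hw.1], by linarith [hc'.lt_add_re, hw.2]⟩).differentiableWithinAt
  · intro w hw _
    refine (hb s l w ⟨le_rfl, le_rfl⟩ le_rfl hw le_rfl).trans ?_
    rw [mul_div_assoc]
    have h0 : 0 < w.re := hc.pos.trans_le hw.1
    have h1 : -(w.re * l.re) ≤ c' * |l.re| := by
      have h2 := neg_abs_le l.re
      have h3 := hw.2
      nlinarith [abs_nonneg l.re]
    gcongr
    exact exp_neg_mul_abs_le hε _

theorem IsOddPolarKernel.mellinKernelIntegral_eq (hg : IsOddPolarKernel a b C g) {s l : ℂ}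
    {c c' : ℝ} (hc : IsAdmissible a s c) (hc' : IsAdmissible a s c')
    (hl : |l.im| < Real.pi / 2 - b) :
    mellinKernelIntegral g c s l = mellinKernelIntegral g c' s l := by
  rcases le_total c c' with h | h
  · exact hg.mellinKernelIntegral_eq_of_le hc hc' h hl
  · exact (hg.mellinKernelIntegral_eq_of_le hc' hc h hl).symm

theorem IsAdmissible.exists_nhd {s : ℂ} {c : ℝ} (hc : IsAdmissible a s c) :
    ∃ r, 0 < r ∧ s.re + r < 2 * c ∧ 2 * c < a + (s.re - r) := by
  obtain ⟨r, h₀, h⟩ := exists_between (lt_min (sub_pos.mpr hc.re_lt) (sub_pos.mpr hc.lt_add_re))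
  exact ⟨r, h₀, by linarith [h.trans_le (min_le_left _ _)],
    by linarith [h.trans_le (min_le_right _ _)]⟩

theorem mem_Icc_of_mem_ball {s s₀ : ℂ} {r : ℝ} (h : s ∈ Metric.ball s₀ r) :
    s.re ∈ Icc (s₀.re - r) (s₀.re + r) ∧ s.im ∈ Icc (s₀.im - r) (s₀.im + r) := by
  rw [mem_ball_iff_norm] at h
  have h1 := (abs_re_le_norm (s - s₀)).trans h.le
  have h2 := (abs_im_le_norm (s - s₀)).trans h.le
  rw [sub_re, abs_le] at h1
  rw [sub_im, abs_le] at h2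
  exact ⟨⟨by linarith, by linarith⟩, ⟨by linarith, by linarith⟩⟩

theorem IsOddPolarKernel.differentiableAt_mellinKernelIntegral (hg : IsOddPolarKernel a b C g)
    {s₀ l₀ : ℂ} {c : ℝ} (hc : IsAdmissible a s₀ c) (hl : |l₀.im| < Real.pi / 2 - b) :
    DifferentiableAt ℂ (fun p : ℂ × ℂ => mellinKernelIntegral g c p.1 p.2) (s₀, l₀) := by
  obtain ⟨r₁, hr₁, hr₁q, hr₁p⟩ := hc.exists_nhd
  -- On the ball of radius `r` the abscissa `c` stays admissible and the argument stays inside the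
  -- sector.
  obtain ⟨r, hr₀, hr⟩ := exists_between (lt_min hr₁ (sub_pos.mpr hl))
  have hrr₁ : r < r₁ := hr.trans_le (min_le_left _ _)
  have hrl : r < Real.pi / 2 - b - |l₀.im| := hr.trans_le (min_le_right _ _)
  obtain ⟨M, ε, hM, hε, hb⟩ := hg.exists_norm_mellinKernel_le (p := s₀.re - r) (q := s₀.re + r)
    (t := |s₀.im| + r) (c₁ := c) (c₂ := c) (φ := |l₀.im| + r) hc.pos (by linarith) (by linarith)
    (by linarith)
  have hball : ∀ p ∈ Metric.ball (s₀, l₀) r,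
      p.1 ∈ Metric.ball s₀ r ∧ p.2 ∈ Metric.ball l₀ r := by
    intro p hp
    rwa [← ball_prod_same] at hp
  have hadm : ∀ s ∈ Metric.ball s₀ r, IsAdmissible a s c := by
    intro s hs
    have := (mem_Icc_of_mem_ball hs).1
    exact ⟨hc.pos, by linarith [this.2], by linarith [this.1]⟩
  unfold mellinKernelIntegral
  refine DifferentiableAt.const_mul (differentiableAt_integral_prod_of_dominated
    (F := fun (p : ℂ × ℂ) (y : ℝ) => mellinKernel g p.1 p.2 (c + y * I)) hr₀
    (bound := fun y => M * Real.exp (-(c * l₀.re) + c * r) * Real.exp (-(ε * |y|))) ?_ ?_ ?_ ?_) _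
  · intro p hp
    exact (hg.continuous_mellinKernel_vertical (hadm _ (hball p hp).1)).aestronglyMeasurable
  · intro y p hp
    exact ((hg.differentiableAt_mellinKernel (l := p.2) (w := c + y * I)
      (by simpa using hadm _ (hball p hp).1)).comp p
      (f := fun p : ℂ × ℂ => (p.1, p.2, (c : ℂ) + y * I)) (by fun_prop)).differentiableWithinAt
  · refine Eventually.of_forall fun y p hp => ?_
    have h1 := mem_Icc_of_mem_ball (hball p hp).1
    have h2 := mem_Icc_of_mem_ball (hball p hp).2
    have him : ∀ x x₀ : ℝ, x ∈ Icc (x₀ - r) (x₀ + r) → |x| ≤ |x₀| + r := by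
      intro x x₀ hx
      have := le_abs_self x₀
      have := neg_abs_le x₀
      exact abs_le.mpr ⟨by linarith [hx.1], by linarith [hx.2]⟩
    have h3 := hb p.1 p.2 (c + y * I) h1.1 (him _ _ h1.2) (by simp) (him _ _ h2.2)
    simp only [add_re, ofReal_re, mul_re, I_re, mul_zero, ofReal_im, I_im, mul_one, sub_self,
      add_zero, add_im, mul_im, zero_add] at h3
    refine h3.trans ?_
    gcongr
    have := mul_le_mul_of_nonneg_left h2.1.1 hc.pos.le
    linarith
  · exact (integrable_exp_neg_mul_abs hε).const_mul _

/-- An admissible abscissa, for each `s` with `Re s > -a`. -/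
def midAbscissa (a : ℝ) (s : ℂ) : ℝ := (max 0 s.re / 2 + (a + s.re) / 2) / 2

theorem isAdmissible_of_lt {s : ℂ} {c : ℝ} (h₁ : max 0 s.re / 2 < c) (h₂ : c < (a + s.re) / 2) :
    IsAdmissible a s c := by
  have h3 := le_max_left 0 s.re
  have h4 := le_max_right 0 s.re
  exact ⟨by linarith, by linarith, by linarith⟩

theorem IsAdmissible.max_lt {s : ℂ} {c : ℝ} (h : IsAdmissible a s c) : max 0 s.re / 2 < c := by
  have : max 0 s.re < 2 * c := _root_.max_lt (by linarith [h.pos]) h.re_lt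
  linarith

theorem isAdmissible_midAbscissa (ha : 0 < a) {s : ℂ} (hs : -a < s.re) :
    IsAdmissible a s (midAbscissa a s) := by
  have h : max 0 s.re < a + s.re := max_lt (by linarith) (by linarith)
  exact isAdmissible_of_lt (by unfold midAbscissa; linarith) (by unfold midAbscissa; linarith)

/-- The abscissa `midAbscissa a s` does not depend holomorphically on `s`, but near `s₀` it can be
frozen at its value there without changing the integral. -/
theorem IsOddPolarKernel.analyticOnDomain (hg : IsOddPolarKernel a b C g) (ha : 0 < a) :
    AnalyticOnDomain a b fun s x => mellinKernelIntegral g (midAbscissa a s) s x.log := by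
  rintro ⟨s₀, l₀⟩ ⟨hs, hl⟩
  change |l₀.im| < Real.pi / 2 - b at hl
  have hc := isAdmissible_midAbscissa ha hs
  refine DifferentiableAt.differentiableWithinAt ?_
  refine (hg.differentiableAt_mellinKernelIntegral hc hl).congr_of_eventuallyEq ?_
  have h1 : ∀ᶠ p : ℂ × ℂ in 𝓝 (s₀, l₀), -a < p.1.re :=
    (isOpen_lt continuous_const (by fun_prop)).mem_nhds hs
  have h2 : ∀ᶠ p : ℂ × ℂ in 𝓝 (s₀, l₀), p.1.re < 2 * midAbscissa a s₀ :=
    (isOpen_lt (by fun_prop) continuous_const).mem_nhds hc.re_lt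
  have h3 : ∀ᶠ p : ℂ × ℂ in 𝓝 (s₀, l₀), 2 * midAbscissa a s₀ < a + p.1.re :=
    (isOpen_lt continuous_const (by fun_prop)).mem_nhds hc.lt_add_re
  have h4 : ∀ᶠ p : ℂ × ℂ in 𝓝 (s₀, l₀), |p.2.im| < Real.pi / 2 - b :=
    (isOpen_lt (by fun_prop) continuous_const).mem_nhds hl
  filter_upwards [h1, h2, h3, h4] with p hp1 hp2 hp3 hp4
  exact hg.mellinKernelIntegral_eq (isAdmissible_midAbscissa ha hp1) ⟨hc.pos, hp2, hp3⟩ hp4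

theorem norm_mellinKernelIntegral_le {c : ℝ} {s l : ℂ} {M ε : ℝ} (hε : 0 < ε)
    (h : ∀ y : ℝ, ‖mellinKernel g s l (c + y * I)‖ ≤
      M * Real.exp (-(c * l.re)) * Real.exp (-(ε * |y|))) :
    ‖mellinKernelIntegral g c s l‖ ≤
      (1 / (2 * Real.pi) * M * ∫ y : ℝ, Real.exp (-(ε * |y|))) * Real.exp (-(c * l.re)) := by
  have h1 := norm_integral_le_of_norm_le
    ((integrable_exp_neg_mul_abs hε).const_mul (M * Real.exp (-(c * l.re))))
    (Eventually.of_forall h)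
  rw [integral_const_mul] at h1
  have h2 : ‖(1 / (2 * Real.pi) : ℂ)‖ = 1 / (2 * Real.pi) := by
    simp [abs_of_pos Real.pi_pos]
  rw [mellinKernelIntegral, norm_mul, h2]
  calc _ ≤ 1 / (2 * Real.pi) * (M * Real.exp (-(c * l.re)) *
        ∫ y : ℝ, Real.exp (-(ε * |y|))) := by gcongr
    _ = _ := by ring

theorem IsOddPolarKernel.exists_norm_mellinKernelIntegral_le (hg : IsOddPolarKernel a b C g) {s : ℂ}
    {c φ : ℝ} (hc : IsAdmissible a s c) (hφ : φ < Real.pi / 2 - b) :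
    ∃ B, ∀ l : ℂ, |l.im| ≤ φ → ‖mellinKernelIntegral g c s l‖ ≤ B * Real.exp (-(c * l.re)) := by
  obtain ⟨M, ε, hM, hε, hb⟩ := hg.exists_norm_mellinKernel_le (t := |s.im|) (c₂ := c) hc.pos
    hc.re_lt hc.lt_add_re hφ
  exact ⟨_, fun l hl => norm_mellinKernelIntegral_le hε fun y => by
    simpa using hb s l (c + y * I) ⟨le_rfl, le_rfl⟩ le_rfl (by simp) hl⟩

theorem mellinKernelIntegral_eq_mellinInv {c : ℝ} {s : ℂ} {x : ℝ} (hx : 0 < x) :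
    mellinKernelIntegral g c s (Real.log x) =
      mellinInv c (fun w => Gamma w * g (2 * w - s)) x := by
  rw [mellinKernelIntegral, mellinInv, real_smul]
  push_cast
  congr 2
  funext y
  rw [mellinKernel, smul_eq_mul, cpow_def_of_ne_zero (by exact_mod_cast hx.ne'),
    ← ofReal_log hx.le, mul_comm]
  congr 2
  ring

theorem LogSurface.log_ofReal (x : ℝ) : (LogSurface.ofReal x).log = (Real.log x : ℂ) := rfl

theorem mellinKernel_zero (s w : ℂ) : mellinKernel g s 0 w = Gamma w * g (2 * w - s) := by
  simp [mellinKernel]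

theorem IsOddPolarKernel.hasMellinGamma (hg : IsOddPolarKernel a b C g) (ha : 0 < a) :
    HasMellinGamma a g fun s x => mellinKernelIntegral g (midAbscissa a s) s x.log := by
  intro s w hs hw₁ hw₂
  have hb₀ : 0 < Real.pi / 2 - b := sub_pos.mpr hg.lt_pi_div_two
  have hw := isAdmissible_of_lt hw₁ hw₂
  have hmid := isAdmissible_midAbscissa ha hs
  set f : ℝ → ℂ := fun x =>
    mellinKernelIntegral g (midAbscissa a s) s (LogSurface.ofReal x).log with hf
  have hfc : ∀ c, IsAdmissible a s c → ∀ x, f x = mellinKernelIntegral g c s (Real.log x) :=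
    fun c hc x => hg.mellinKernelIntegral_eq hmid hc (by simpa [LogSurface.log_ofReal] using hb₀)
  have hbound : ∀ c, IsAdmissible a s c → ∃ B, ∀ x, 0 < x → ‖f x‖ ≤ B * ‖x ^ (-c)‖ := by
    intro c hc
    obtain ⟨B, hB⟩ := hg.exists_norm_mellinKernelIntegral_le (φ := 0) hc hb₀
    refine ⟨B, fun x hx => ?_⟩
    rw [hfc c hc x, Real.norm_of_nonneg (by positivity), Real.rpow_def_of_pos hx]
    refine (hB _ (by simp)).trans_eq ?_
    rw [ofReal_re]
    congr 2
    ring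
  have hcont : ContinuousOn f (Ioi 0) := by
    intro x hx
    have h1 := (hg.differentiableAt_mellinKernelIntegral (l₀ := (Real.log x : ℂ)) hmid
      (by simpa using hb₀)).continuousAt
    have h2 : ContinuousAt (fun x : ℝ => (s, ((Real.log x : ℝ) : ℂ))) x := by
      have := Real.continuousAt_log (ne_of_gt hx)
      fun_prop
    exact (ContinuousAt.comp (f := fun x : ℝ => (s, ((Real.log x : ℝ) : ℂ))) h1
      h2).continuousWithinAt
  -- Shifting the line yields `f x = O(x^(-c))` for each admissible `c`: `c₂ > Re w` controls
  -- infinity and `c₁ < Re w` controls zero.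
  have hconv : ∀ w : ℂ, max 0 s.re / 2 < w.re → w.re < (a + s.re) / 2 → MellinConvergent f w := by
    intro w hw₁ hw₂
    obtain ⟨c₁, hc₁, hc₁w⟩ := exists_between hw₁
    obtain ⟨c₂, hwc₂, hc₂⟩ := exists_between hw₂
    obtain ⟨B₁, hB₁⟩ := hbound c₁ (isAdmissible_of_lt hc₁ (hc₁w.trans hw₂))
    obtain ⟨B₂, hB₂⟩ := hbound c₂ (isAdmissible_of_lt (hw₁.trans hwc₂) hc₂)
    refine mellinConvergent_of_isBigO_rpow (hcont.locallyIntegrableOn measurableSet_Ioi)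
      (a := c₂) (Asymptotics.IsBigO.of_bound B₂ ?_) hwc₂
      (b := c₁) (Asymptotics.IsBigO.of_bound B₁ ?_) hc₁w
    · filter_upwards [eventually_gt_atTop 0] with x hx using hB₂ x hx
    · filter_upwards [self_mem_nhdsWithin] with x hx using hB₁ x hx
  have hinv : ∀ x ∈ Ioi (0 : ℝ), f x = mellinInv w.re (fun w => Gamma w * g (2 * w - s)) x :=
    fun x hx => by rw [hfc w.re hw, mellinKernelIntegral_eq_mellinInv hx]
  refine ⟨hconv w hw₁ hw₂, ?_⟩
  have hmellin : mellin f w =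
      mellin (mellinInv w.re (fun w => Gamma w * g (2 * w - s))) w := by
    refine setIntegral_congr_fun measurableSet_Ioi fun x hx => ?_
    simp only [hinv x hx]
  rw [hmellin]
  refine mellin_mellinInv_eq (F := fun w => Gamma w * g (2 * w - s)) ?_ ?_ ?_
  · simpa only [mellinKernel_zero] using hg.continuous_mellinKernel_vertical (l := 0) hw
  · have := hg.integrable_mellinKernel (l := 0) hw (by simpa using hb₀)
    simp only [mellinKernel_zero] at this
    exact this
  · refine (hconv (w.re : ℂ) (by simpa using hw₁) (by simpa using hw₂)).congr_fun ?_
      measurableSet_Ioi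
    intro x hx
    simp only [hinv x hx]

/-- The function `h` is uniquely determined: it is the inverse Mellin integral. -/
theorem IsOddPolarKernel.eq_mellinKernelIntegral (hg : IsOddPolarKernel a b C g)
    {h : ℂ → LogSurface → ℂ} (hana : AnalyticOnDomain a b h) (hmel : HasMellinGamma a g h)
    {s : ℂ} (hs : -a < s.re) {c : ℝ} (hc : IsAdmissible a s c) {x : LogSurface}
    (hx : |x.arg| < Real.pi / 2 - b) : h s x = mellinKernelIntegral g c s x.log := by
  have hb₀ : 0 < Real.pi / 2 - b := sub_pos.mpr hg.lt_pi_div_two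
  set U : Set ℂ := {l : ℂ | |l.im| < Real.pi / 2 - b} with hU
  have hUo : IsOpen U := isOpen_lt (by fun_prop) continuous_const
  have hUc : IsPreconnected U := by
    have h1 : Convex ℝ (Ioo (-(Real.pi / 2 - b)) (Real.pi / 2 - b)) := convex_Ioo _ _
    have h2 := h1.linear_preimage imLm
    convert h2.isPreconnected using 1
    ext l
    simp [hU, abs_lt]
  have hdom : IsOpen {p : ℂ × ℂ | -a < p.1.re ∧ |(⟨p.2⟩ : LogSurface).arg| < Real.pi / 2 - b} := by
    have h1 : IsOpen {p : ℂ × ℂ | -a < p.1.re} := isOpen_lt continuous_const (by fun_prop)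
    have h2 : IsOpen {p : ℂ × ℂ | |p.2.im| < Real.pi / 2 - b} :=
      isOpen_lt (by fun_prop) continuous_const
    exact h1.inter h2
  have hd₁ : DifferentiableOn ℂ (fun l => h s ⟨l⟩) U := by
    intro l hl
    exact ((hana.differentiableAt (hdom.mem_nhds (x := (s, l)) ⟨hs, hl⟩)).comp l
      (f := fun l => (s, l)) (by fun_prop)).differentiableWithinAt
  have hd₂ : DifferentiableOn ℂ (fun l => mellinKernelIntegral g c s l) U := by
    intro l hl
    exact ((hg.differentiableAt_mellinKernelIntegral hc hl).comp l
      (f := fun l => (s, l)) (by fun_prop)).differentiableWithinAt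
  -- Mellin inversion determines `h` on the positive axis, i.e. for real logarithm; the identity
  -- theorem then covers the strip `U` of logarithms.
  have hreal : ∀ r : ℝ, h s ⟨(r : ℂ)⟩ = mellinKernelIntegral g c s (r : ℂ) := by
    intro r
    set f : ℝ → ℂ := fun x => h s (LogSurface.ofReal x) with hf
    have hM : ∀ y : ℝ, HasMellin f (c + y * I)
        (Gamma (c + y * I) * g (2 * (c + y * I) - s)) := fun y =>
      hmel s (c + y * I) hs (by simpa using hc.max_lt) (by simp; linarith [hc.lt_add_re])
    have h0 := (hM 0).1
    simp only [ofReal_zero, zero_mul, add_zero] at h0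
    have hpos : 0 < Real.exp r := Real.exp_pos r
    have hcont : ContinuousAt f (Real.exp r) := by
      have h1 := (hd₁.differentiableAt (x := (Real.log (Real.exp r) : ℂ))
        (hUo.mem_nhds (by simpa [hU] using hb₀))).continuousAt
      have h2 : ContinuousAt (fun x : ℝ => ((Real.log x : ℝ) : ℂ)) (Real.exp r) := by
        have := Real.continuousAt_log hpos.ne'
        fun_prop
      exact ContinuousAt.comp (f := fun x : ℝ => ((Real.log x : ℝ) : ℂ)) h1 h2
    have hvert : VerticalIntegrable (mellin f) c := by
      have := hg.integrable_mellinKernel (l := 0) hc (by simpa using hb₀)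
      refine Integrable.congr this (Eventually.of_forall fun y => ?_)
      simp only [mellinKernel_zero, (hM y).2]
    have hfin := mellinInv_mellin_eq c f hpos h0 hvert hcont
    have hline : mellinInv c (mellin f) (Real.exp r) =
        mellinInv c (fun w => Gamma w * g (2 * w - s)) (Real.exp r) := by
      unfold mellinInv
      congr 2
      funext y
      rw [(hM y).2]
    rw [hline, ← mellinKernelIntegral_eq_mellinInv hpos, Real.log_exp] at hfin
    rw [hfin]
    simp [hf, LogSurface.ofReal]
  have := (hd₁.analyticOnNhd hUo).eqOn_of_preconnected_of_frequently_eq (hd₂.analyticOnNhd hUo) hUc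
    (z₀ := ((0 : ℝ) : ℂ)) (by simpa [hU] using hb₀)
    (frequently_punctured_nhds_of_forall_ofReal (Eventually.of_forall hreal))
  exact this (show x.log ∈ U from hx)

end MellinKernel

/-! ### Uniform convergence on compact sets -/

section UniformConvergence

/-- Weierstrass's M-test: finitely many local majorants cover a compact set, and their sum is a
majorant there. -/
theorem convergesAbsUniformly_of_locally_summable_bound {f : ℕ → ℂ → ℂ} {U : Set ℂ}
    (h : ∀ s ∈ U, ∃ V ∈ 𝓝 s, ∃ u : ℕ → ℝ, Summable u ∧ ∀ n, ∀ z ∈ V, ‖f n z‖ ≤ u n) :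
    ConvergesAbsUniformly f U := by
  refine ⟨fun s hs => ?_, fun K hKU hK => ?_⟩
  · obtain ⟨V, hV, u, hu, hb⟩ := h s hs
    exact hu.of_nonneg_of_le (fun _ => norm_nonneg _) fun n => hb n s (mem_of_mem_nhds hV)
  · obtain ⟨u, hu, hb⟩ : ∃ u : ℕ → ℝ, Summable u ∧ ∀ n, ∀ z ∈ K, ‖f n z‖ ≤ u n := by
      refine hK.induction_on (p := fun K => ∃ u : ℕ → ℝ, Summable u ∧ ∀ n, ∀ z ∈ K, ‖f n z‖ ≤ u n)
        ⟨0, summable_zero, by simp⟩ ?_ ?_ ?_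
      · rintro s t hst ⟨u, hu, hb⟩
        exact ⟨u, hu, fun n z hz => hb n z (hst hz)⟩
      · rintro s t ⟨u, hu, hbu⟩ ⟨v, hv, hbv⟩
        refine ⟨fun n => |u n| + |v n|, hu.abs.add hv.abs, fun n z hz => ?_⟩
        rcases hz with hz | hz
        · exact (hbu n z hz).trans ((le_abs_self _).trans (le_add_of_nonneg_right (abs_nonneg _)))
        · exact (hbv n z hz).trans ((le_abs_self _).trans (le_add_of_nonneg_left (abs_nonneg _)))
      · intro s hs
        obtain ⟨V, hV, u, hu, hb⟩ := h s (hKU hs)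
        exact ⟨V, mem_nhdsWithin_of_mem_nhds hV, u, hu, hb⟩
    exact ⟨tendstoUniformlyOn_tsum_nat hu hb,
      tendstoUniformlyOn_tsum_nat hu fun n z hz => by simpa using hb n z hz⟩

theorem ConvergesAbsUniformly.comp {f : ℕ → ℂ → ℂ} {U V : Set ℂ} {φ : ℂ → ℂ}
    (hf : ConvergesAbsUniformly f V) (hφ : Continuous φ) (hmaps : MapsTo φ U V) :
    ConvergesAbsUniformly (fun n s => f n (φ s)) U := by
  refine ⟨fun s hs => hf.1 _ (hmaps hs), fun K hKU hK => ?_⟩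
  obtain ⟨h₁, h₂⟩ := hf.2 (φ '' K) (image_subset_iff.mpr fun s hs => hmaps (hKU hs))
    (hK.image hφ)
  exact ⟨(h₁.comp φ).mono (subset_preimage_image φ K), (h₂.comp φ).mono (subset_preimage_image φ K)⟩

end UniformConvergence

/-! ### The series over `n` and the residue computation -/

section ZetaRepresentation

open MeasureTheory

variable {a b C : ℝ} {g : ℂ → ℂ}

theorem LogSurface.log_ofReal_mul (x : ℝ) (τ : LogSurface) :
    (LogSurface.ofReal x * τ).log = (Real.log x : ℂ) + τ.log := rfl

theorem LogSurface.arg_ofReal_mul (x : ℝ) (τ : LogSurface) :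
    (LogSurface.ofReal x * τ).arg = τ.arg := by
  simp [LogSurface.arg, LogSurface.log_ofReal_mul]

/-- Indices start at `0`, so `n + 1` plays the role of the summation variable `n ≥ 1`. -/
theorem log_pi_mul_sq (n : ℕ) :
    Real.log (Real.pi * ((n : ℝ) + 1) ^ 2) = Real.log Real.pi + 2 * Real.log ((n : ℝ) + 1) := by
  rw [Real.log_mul Real.pi_ne_zero (by positivity), Real.log_pow]
  norm_num

theorem exp_neg_mul_log_pi_mul_sq_add (c R : ℝ) (n : ℕ) :
    Real.exp (-(c * (Real.log (Real.pi * ((n : ℝ) + 1) ^ 2) + R))) =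
      Real.exp (-(c * (Real.log Real.pi + R))) * (1 / ((n : ℝ) + 1) ^ (2 * c)) := by
  rw [log_pi_mul_sq, Real.rpow_def_of_pos (by positivity), one_div, ← Real.exp_neg, ← Real.exp_add]
  congr 1
  ring

theorem summable_one_div_nat_add_one_rpow {c : ℝ} (hc : 1 / 2 < c) :
    Summable fun n : ℕ => 1 / ((n : ℝ) + 1) ^ (2 * c) := by
  have := (summable_nat_add_iff 1).mpr (Real.summable_one_div_nat_rpow.mpr
    (show 1 < 2 * c by linarith))
  simpa using this

/-- The forms `-(2 * w) / 2` and `2 * w / 2` match the factors of `Λ(2w)` in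
`completedRiemannZeta_eq_mul`. -/
theorem mellinKernel_log_pi_mul_sq_add (s l w : ℂ) (n : ℕ) :
    mellinKernel g s ((Real.log (Real.pi * ((n : ℝ) + 1) ^ 2) : ℝ) + l) w =
      1 / ((n : ℂ) + 1) ^ (2 * w) *
        ((Real.pi : ℂ) ^ (-(2 * w) / 2) * Gamma (2 * w / 2) * (g (2 * w - s) * cexp (-(w * l)))) := by
  have h1 : (n : ℂ) + 1 = (((n : ℝ) + 1 : ℝ) : ℂ) := by push_cast; rfl
  have h2 : (0 : ℝ) < (n : ℝ) + 1 := by positivity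
  rw [mellinKernel, log_pi_mul_sq, h1, cpow_def_of_ne_zero (by exact_mod_cast h2.ne'),
    cpow_def_of_ne_zero (by exact_mod_cast Real.pi_ne_zero), ← ofReal_log h2.le,
    ← ofReal_log Real.pi_pos.le, one_div, ← Complex.exp_neg,
    mul_div_cancel_left₀ w two_ne_zero]
  have h3 : cexp (-(w * (((Real.log Real.pi + 2 * Real.log ((n : ℝ) + 1) : ℝ) : ℂ) + l))) =
      cexp (-((Real.log ((n : ℝ) + 1) : ℝ) * (2 * w))) *
        (cexp ((Real.log Real.pi : ℝ) * (-(2 * w) / 2)) * cexp (-(w * l))) := by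
    rw [← Complex.exp_add, ← Complex.exp_add]
    congr 1
    push_cast
    ring
  rw [h3]
  ring

theorem tsum_mellinKernel_log_pi_mul_sq_add {s l w : ℂ} (hw : 1 / 2 < w.re) :
    ∑' n : ℕ, mellinKernel g s ((Real.log (Real.pi * ((n : ℝ) + 1) ^ 2) : ℝ) + l) w =
      completedRiemannZeta (2 * w) * g (2 * w - s) * cexp (-(w * l)) := by
  have h2w : (2 * w).re = 2 * w.re := by simp
  simp_rw [mellinKernel_log_pi_mul_sq_add]
  rw [tsum_mul_right, ← zeta_eq_tsum_one_div_nat_add_one_cpow (by rw [h2w]; linarith),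
    completedRiemannZeta_eq_mul]
  · ring
  · intro k hk
    have h := congrArg re hk
    rw [h2w] at h
    simp at h
    linarith [(k.cast_nonneg : (0 : ℝ) ≤ k)]

theorem IsOddPolarKernel.tsum_mellinKernelIntegral (hg : IsOddPolarKernel a b C g) {s l : ℂ}
    {c : ℝ} (hc : IsAdmissible a s c) (hc₂ : 1 / 2 < c) (hl : |l.im| < Real.pi / 2 - b) :
    ∑' n : ℕ, mellinKernelIntegral g c s ((Real.log (Real.pi * ((n : ℝ) + 1) ^ 2) : ℝ) + l) =
      1 / (2 * Real.pi) * ∫ y : ℝ, completedRiemannZeta (2 * (c + y * I)) *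
        g (2 * (c + y * I) - s) * cexp (-((c + y * I) * l)) := by
  obtain ⟨M, ε, hM, hε, hb⟩ := hg.exists_norm_mellinKernel_le (t := |s.im|) (c₂ := c) hc.pos
    hc.re_lt hc.lt_add_re hl
  unfold mellinKernelIntegral
  rw [tsum_mul_left]
  congr 1
  have hint : ∀ n : ℕ, Integrable fun y : ℝ => mellinKernel g s
      ((Real.log (Real.pi * ((n : ℝ) + 1) ^ 2) : ℝ) + l) (c + y * I) := fun n =>
    hg.integrable_mellinKernel hc (by simpa using hl)
  -- Sum and integral may be exchanged because the norms integrate to `O((n + 1)^(-2c))` with `2c >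
  -- 1`.
  have hsum := hasSum_integral_of_summable_integral_norm hint ?_
  · rw [hsum.tsum_eq]
    congr 1
    funext y
    exact tsum_mellinKernel_log_pi_mul_sq_add (by simpa using hc₂)
  · refine Summable.of_nonneg_of_le (fun n => integral_nonneg fun _ => norm_nonneg _) (fun n => ?_)
      ((summable_one_div_nat_add_one_rpow hc₂).mul_left
        (M * Real.exp (-(c * (Real.log Real.pi + l.re))) * ∫ y : ℝ, Real.exp (-(ε * |y|))))
    have h1 : ∀ y : ℝ, ‖mellinKernel g s
        ((Real.log (Real.pi * ((n : ℝ) + 1) ^ 2) : ℝ) + l) (c + y * I)‖ ≤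
        M * Real.exp (-(c * (Real.log (Real.pi * ((n : ℝ) + 1) ^ 2) + l.re))) *
          Real.exp (-(ε * |y|)) := fun y => by
      simpa using hb s ((Real.log (Real.pi * ((n : ℝ) + 1) ^ 2) : ℝ) + l) (c + y * I)
        ⟨le_rfl, le_rfl⟩ le_rfl (by simp) (by simp)
    refine (integral_mono (hint n).norm ((integrable_exp_neg_mul_abs hε).const_mul _)
      h1).trans_eq ?_
    rw [integral_const_mul, exp_neg_mul_log_pi_mul_sq_add]
    ring

/-- The left edge `1 - a` of the strip arises here: an admissible `c` with `2c > 1` requires `1 < a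
+ Re s`. -/
theorem exists_isAdmissible_half_lt {s : ℂ} (ha : 0 < a) (hs : 1 - a < s.re) :
    ∃ c, IsAdmissible a s c ∧ 1 / 2 < c := by
  obtain ⟨c, hc₁, hc₂⟩ := exists_between
    (show max 1 s.re / 2 < (a + s.re) / 2 by
      have : max 1 s.re < a + s.re := max_lt (by linarith) (by linarith)
      linarith)
  have h1 := le_max_left 1 s.re
  have h2 := le_max_right 1 s.re
  exact ⟨c, ⟨by linarith, by linarith, by linarith⟩, by linarith⟩

theorem IsOddPolarKernel.convergesAbsUniformly (hg : IsOddPolarKernel a b C g) (ha : 0 < a)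
    {h : ℂ → LogSurface → ℂ} (hana : AnalyticOnDomain a b h) (hmel : HasMellinGamma a g h)
    {τ : LogSurface} (hτ : |τ.arg| < Real.pi / 2 - b) :
    ConvergesAbsUniformly
      (fun n s => h s (LogSurface.ofReal (Real.pi * ((n : ℝ) + 1) ^ 2) * τ))
      {s : ℂ | 1 - a < s.re ∧ s.re < a} := by
  refine convergesAbsUniformly_of_locally_summable_bound fun s₀ hs₀ => ?_
  obtain ⟨c, hc, hc₂⟩ := exists_isAdmissible_half_lt ha hs₀.1
  obtain ⟨r₁, hr₁, hr₁q, hr₁p⟩ := hc.exists_nhd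
  -- One abscissa `c > 1/2` serves the whole ball, giving the majorant `(n + 1)^(-2c)`; the second
  -- bound on `r` keeps `Re s > -a`.
  obtain ⟨r, hr₀, hr⟩ := exists_between (lt_min hr₁ (show 0 < s₀.re + a by linarith [hs₀.1]))
  have hrr₁ : r < r₁ := hr.trans_le (min_le_left _ _)
  have hra : r < s₀.re + a := hr.trans_le (min_le_right _ _)
  obtain ⟨M, ε, hM, hε, hb⟩ := hg.exists_norm_mellinKernel_le (p := s₀.re - r) (q := s₀.re + r)
    (t := |s₀.im| + r) (c₁ := c) (c₂ := c) (φ := |τ.arg|) hc.pos (by linarith) (by linarith) hτ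
  refine ⟨Metric.ball s₀ r, Metric.ball_mem_nhds _ hr₀, _,
    (summable_one_div_nat_add_one_rpow hc₂).mul_left
      ((1 / (2 * Real.pi) * M * ∫ y : ℝ, Real.exp (-(ε * |y|))) *
        Real.exp (-(c * (Real.log Real.pi + τ.log.re)))), fun n s hs => ?_⟩
  have hmem := mem_Icc_of_mem_ball hs
  have hsim : |s.im| ≤ |s₀.im| + r := by
    have := le_abs_self s₀.im
    have := neg_abs_le s₀.im
    exact abs_le.mpr ⟨by linarith [hmem.2.1], by linarith [hmem.2.2]⟩
  have hcs : IsAdmissible a s c :=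
    ⟨hc.pos, by linarith [hmem.1.2], by linarith [hmem.1.1]⟩
  rw [hg.eq_mellinKernelIntegral hana hmel (by linarith [hmem.1.1]) hcs
    (by rwa [LogSurface.arg_ofReal_mul]), LogSurface.log_ofReal_mul, mul_assoc,
    ← exp_neg_mul_log_pi_mul_sq_add]
  have hk := norm_mellinKernelIntegral_le (g := g) (c := c) (s := s)
    (l := (Real.log (Real.pi * ((n : ℝ) + 1) ^ 2) : ℝ) + τ.log) (M := M) hε fun y => by
      simpa using hb s ((Real.log (Real.pi * ((n : ℝ) + 1) ^ 2) : ℝ) + τ.log) (c + y * I) hmem.1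
        hsim (by simp) (by simp [LogSurface.arg])
  simpa using hk

theorem completedRiemannZeta_residue_zero :
    Tendsto (fun s => s * completedRiemannZeta s) (𝓝[≠] 0) (𝓝 (-1)) := by
  have h1 : Tendsto (fun s : ℂ => 1 - s) (𝓝[≠] 0) (𝓝[≠] 1) := by
    refine tendsto_nhdsWithin_iff.mpr ⟨?_, ?_⟩
    · have : Continuous fun s : ℂ => 1 - s := by fun_prop
      simpa using (this.tendsto 0).mono_left nhdsWithin_le_nhds
    · filter_upwards [self_mem_nhdsWithin] with s hs
      simpa using hs
  refine ((completedRiemannZeta_residue_one.comp h1).neg).congr fun s => ?_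
  simp only [Function.comp_apply, completedRiemannZeta_one_sub]
  ring

/-- The integrand `Λ(v + s) g(v) τ ^ (-v / 2)` with `τ = exp l`. -/
def zetaKernel (g : ℂ → ℂ) (s l v : ℂ) : ℂ :=
  completedRiemannZeta (v + s) * g v * cexp (-(v * l) / 2)

theorem IsOddPolarKernel.differentiableAt_zetaKernel (hg : IsOddPolarKernel a b C g) {s l v : ℂ}
    (hv : |v.re| < a) (h0 : v ≠ 0) (h1 : v ≠ 1 - s) (h2 : v ≠ -s) :
    DifferentiableAt ℂ (zetaKernel g s l) v := by
  have hd : DifferentiableAt ℂ completedRiemannZeta (v + s) :=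
    differentiableAt_completedZeta (fun h => h2 (eq_neg_of_add_eq_zero_left h))
      (fun h => h1 (eq_sub_of_add_eq h))
  have hg' := hg.differentiableAt hv h0
  have hd' : DifferentiableAt ℂ (fun v => completedRiemannZeta (v + s)) v :=
    hd.comp v (f := fun v => v + s) (by fun_prop)
  unfold zetaKernel
  fun_prop

/-- The rates are `κ` of decay for `Λ` against growth `b/2` for `g` and `|Im l|/2` for the
exponential. A suitable `κ < π/4` exists exactly because `|Im l| < π/2 - b`. -/
theorem IsOddPolarKernel.exists_norm_zetaKernel_le (hg : IsOddPolarKernel a b C g) (hC : 0 < C)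
    {s l : ℂ} (hl : |l.im| < Real.pi / 2 - b) {D : ℝ} (hD : D < a) :
    ∃ M, ∀ v : ℂ, |v.re| ≤ D → |s.im| + 2 ≤ |v.im| →
      ‖zetaKernel g s l v‖ ≤ M / (1 + v.im ^ 2) := by
  have hb := hg.lt_pi_div_two
  obtain ⟨κ, hκ₁, hκ₂⟩ := exists_between (show max 0 ((b + |l.im|) / 2) < Real.pi / 4 from
    max_lt (by linarith [Real.pi_pos]) (by linarith))
  have hκ₀ : 0 ≤ κ := (le_max_left _ _).trans hκ₁.le
  have hκ : (b + |l.im|) / 2 < κ := (le_max_right _ _).trans_lt hκ₁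
  -- Large enough for `Re(v + s)` to lie in `[1 - β, β]`.
  set β : ℝ := max 2 (1 + D + |s.re|) with hβ
  have hβ₁ : 1 < β := one_lt_two.trans_le (le_max_left _ _)
  obtain ⟨M, hM₀, hM⟩ := exists_norm_completedRiemannZeta_le hβ₁ hκ₀ hκ₂
  set ε := κ - (b + |l.im|) / 2 with hε
  have hε₀ : 0 < ε := sub_pos.mpr hκ
  refine ⟨M * C * Real.exp (κ * |s.im| + D * |l.re| / 2) * (4 / ε ^ 2 * Real.exp ε),
    fun v hv hvim => ?_⟩
  have hβ₂ : 1 + D + |s.re| ≤ β := le_max_right _ _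
  have h1 := hM (v + s)
    (by
      rw [add_re]
      have h1 := abs_le.mp hv
      have h2 := neg_abs_le s.re
      have h3 := le_abs_self s.re
      exact ⟨by linarith, by linarith⟩)
    (by
      rw [add_im]
      have := abs_sub_abs_le_abs_add v.im s.im
      linarith)
  have h2 : |v.im| - |s.im| ≤ |(v + s).im| := by
    rw [add_im]; exact abs_sub_abs_le_abs_add _ _
  have h3 := (hg.norm_lt v (hv.trans_lt hD) (by linarith [abs_nonneg s.im])).le
  have h4 : ‖cexp (-(v * l) / 2)‖ ≤ Real.exp (D * |l.re| / 2 + |v.im| * |l.im| / 2) := by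
    rw [norm_exp]
    gcongr
    have e1 : -(v.re * l.re) ≤ D * |l.re| := by
      refine (neg_le_abs _).trans ?_
      rw [abs_mul]
      gcongr
    have e2 : v.im * l.im ≤ |v.im| * |l.im| := by
      rw [← abs_mul]; exact le_abs_self _
    have e3 : (-(v * l) / 2).re = (-(v.re * l.re) + v.im * l.im) / 2 := by
      simp
      ring
    rw [e3]
    linarith
  rw [zetaKernel, norm_mul, norm_mul]
  calc _ ≤ (M * Real.exp (-(κ * (|v.im| - |s.im|)))) * (C * Real.exp (b * |v.im| / 2)) *
        Real.exp (D * |l.re| / 2 + |v.im| * |l.im| / 2) := by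
          gcongr
          refine h1.trans ?_
          gcongr
    _ = M * C * (Real.exp (-(κ * (|v.im| - |s.im|))) * Real.exp (b * |v.im| / 2) *
        Real.exp (D * |l.re| / 2 + |v.im| * |l.im| / 2)) := by ring
    _ = M * C * (Real.exp (κ * |s.im| + D * |l.re| / 2) * Real.exp (-(ε * |v.im|))) := by
          simp only [← Real.exp_add]
          congr 2
          rw [hε]
          ring
    _ ≤ M * C * (Real.exp (κ * |s.im| + D * |l.re| / 2) *
        ((4 / ε ^ 2 * Real.exp ε) / (1 + v.im ^ 2))) := by
          gcongr
          exact exp_neg_mul_abs_le hε₀ _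
    _ = _ := by ring

theorem tendsto_mul_residue {u φ ψ : ℂ → ℂ} {p r : ℂ}
    (hu : Tendsto (fun v => (v - p) * u v) (𝓝[≠] p) (𝓝 r)) (hφ : ContinuousAt φ p)
    (hψ : ContinuousAt ψ p) :
    Tendsto (fun v => (v - p) * (u v * (φ v * ψ v))) (𝓝[≠] p) (𝓝 (r * (φ p * ψ p))) := by
  refine (hu.mul ((hφ.tendsto.mul hψ.tendsto).mono_left nhdsWithin_le_nhds)).congr fun v => ?_
  ring

theorem tendsto_residue_comp_add {u : ℂ → ℂ} {p s r : ℂ}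
    (hu : Tendsto (fun v => (v - (p + s)) * u v) (𝓝[≠] (p + s)) (𝓝 r)) :
    Tendsto (fun v => (v - p) * u (v + s)) (𝓝[≠] p) (𝓝 r) := by
  have h1 : Tendsto (fun v : ℂ => v + s) (𝓝[≠] p) (𝓝[≠] (p + s)) := by
    refine tendsto_nhdsWithin_iff.mpr ⟨?_, ?_⟩
    · have : Continuous fun v : ℂ => v + s := by fun_prop
      exact (this.tendsto p).mono_left nhdsWithin_le_nhds
    · filter_upwards [self_mem_nhdsWithin] with v hv
      simpa using hv
  refine (hu.comp h1).congr fun v => ?_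
  simp only [Function.comp_apply]
  ring

/-- The poles between the lines are `v = 0` from `g`, and `v = 1 - s`, `v = -s` from `Λ(v + s)`.
They are distinct, hence simple, because `s ≠ 0, 1`. -/
theorem IsOddPolarKernel.integral_zetaKernel_sub (hg : IsOddPolarKernel a b C g) (hC : 0 < C)
    {s l : ℂ} (hl : |l.im| < Real.pi / 2 - b) (hs₀ : s ≠ 0) (hs₁ : s ≠ 1) (hsa : s.re < a)
    (hsa' : 1 - a < s.re) {d₁ d₂ : ℝ} (hd₁ : max (1 - s.re) 0 < d₁) (hd₁a : d₁ < a)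
    (hd₂ : max s.re 0 < d₂) (hd₂a : d₂ < a) :
    (∫ y : ℝ, zetaKernel g s l (d₁ + y * I)) - ∫ y : ℝ, zetaKernel g s l ((-d₂ : ℝ) + y * I) =
      2 * Real.pi * (completedRiemannZeta s + g (1 - s) * cexp ((s - 1) / 2 * l) +
        g s * cexp (s / 2 * l)) := by
  have hd₁0 : 0 < d₁ := (le_max_right _ _).trans_lt hd₁
  have hd₁s : 1 - s.re < d₁ := (le_max_left _ _).trans_lt hd₁
  have hd₂0 : 0 < d₂ := (le_max_right _ _).trans_lt hd₂
  have hd₂s : s.re < d₂ := (le_max_left _ _).trans_lt hd₂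
  have hs1 : (1 : ℂ) - s ≠ 0 := sub_ne_zero.mpr hs₁.symm
  have hne : -s ≠ 1 - s := fun h => by
    have : (0 : ℂ) = 1 := by linear_combination h
    exact zero_ne_one this
  have habs : |s.re| < a := abs_lt.mpr ⟨by linarith, hsa⟩
  have habs1 : |(1 - s).re| < a := by
    rw [sub_re, one_re]
    exact abs_lt.mpr ⟨by linarith, by linarith⟩
  obtain ⟨M, hM⟩ := hg.exists_norm_zetaKernel_le hC (s := s) hl (max_lt hd₁a hd₂a)
  set r : ℂ → ℂ := fun p => if p = 0 then completedRiemannZeta s else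
    if p = 1 - s then g (1 - s) * cexp ((s - 1) / 2 * l) else g s * cexp (s / 2 * l) with hr
  have hexp : Continuous fun v : ℂ => cexp (-(v * l) / 2) := by fun_prop
  rw [integral_vertical_sub_eq_sum_residues (α := -d₂) (β := d₁) (by linarith) r {0, 1 - s, -s}
    (M := M) (T := |s.im| + 2)]
  · rw [Finset.sum_insert (by simp [hs1.symm, hs₀]),
      Finset.sum_insert (by simp), Finset.sum_singleton]
    simp only [hr, if_true, if_neg hs1, if_neg (neg_ne_zero.mpr hs₀), if_neg hne]
    ring
  · intro p hp
    simp only [Finset.mem_insert, Finset.mem_singleton] at hp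
    rcases hp with rfl | rfl | rfl
    · exact ⟨by simpa using hd₂0, by simpa using hd₁0⟩
    · simp only [sub_re, one_re]; exact ⟨by linarith, by linarith⟩
    · simp only [neg_re]; exact ⟨by linarith, by linarith⟩
  · rintro v ⟨hv, hv'⟩
    simp only [Finset.coe_insert, Finset.coe_singleton, mem_insert_iff, mem_singleton_iff,
      not_or] at hv'
    refine (hg.differentiableAt_zetaKernel ?_ hv'.1 hv'.2.1 hv'.2.2).differentiableWithinAt
    exact abs_lt.mpr ⟨by linarith [hv.1], by linarith [hv.2]⟩
  · intro p hp
    simp only [Finset.mem_insert, Finset.mem_singleton] at hp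
    rcases hp with rfl | rfl | rfl
    · have hΛ : ContinuousAt (fun v => completedRiemannZeta (v + s)) 0 := by
        have h := (differentiableAt_completedZeta hs₀ hs₁).continuousAt
        rw [← zero_add s] at h
        exact ContinuousAt.comp (f := fun v => v + s) h (by fun_prop)
      have h0 : Tendsto (fun v => (v - 0) * g v) (𝓝[≠] 0) (𝓝 1) := by simpa using hg.residue
      have h := tendsto_mul_residue h0 hΛ hexp.continuousAt
      simp only [hr, if_true]
      simp only [zero_add, zero_mul, neg_zero, zero_div, Complex.exp_zero, mul_one, one_mul] at h
      refine h.congr fun v => ?_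
      rw [zetaKernel]; ring
    · have h0 : Tendsto (fun v => (v - (1 - s + s)) * completedRiemannZeta v) (𝓝[≠] (1 - s + s))
          (𝓝 1) := by
        rw [sub_add_cancel]
        exact completedRiemannZeta_residue_one
      have h := tendsto_mul_residue (tendsto_residue_comp_add h0)
        (hg.differentiableAt habs1 hs1).continuousAt hexp.continuousAt
      simp only [hr, if_neg hs1, if_true]
      rw [one_mul, show -((1 - s) * l) / 2 = (s - 1) / 2 * l by ring] at h
      refine h.congr fun v => ?_
      rw [zetaKernel]; ring
    -- The residue `-1` of `Λ` at `0` and `g(-s) = -g(s)` combine to a plus sign.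
    · have h0 : Tendsto (fun v => (v - (-s + s)) * completedRiemannZeta v) (𝓝[≠] (-s + s))
          (𝓝 (-1)) := by
        rw [neg_add_cancel]
        simpa using completedRiemannZeta_residue_zero
      have h := tendsto_mul_residue (tendsto_residue_comp_add h0)
        (hg.differentiableAt (by simpa using habs) (neg_ne_zero.mpr hs₀)).continuousAt
        hexp.continuousAt
      simp only [hr, if_neg (neg_ne_zero.mpr hs₀), if_neg hne]
      rw [hg.odd s habs hs₀, show -(-s * l) / 2 = s / 2 * l by ring] at h
      rw [show g s * cexp (s / 2 * l) = -1 * (-g s * cexp (s / 2 * l)) by ring]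
      refine h.congr fun v => ?_
      rw [zetaKernel]; ring
  · intro v hv hvim
    refine hM v (abs_le.mpr ⟨?_, hv.2.trans (le_max_left _ _)⟩) hvim
    linarith [hv.1, le_max_right d₁ d₂]

theorem integral_comp_two_mul_sub (f : ℝ → ℂ) (t : ℝ) :
    ∫ y : ℝ, f (2 * y - t) = 1 / 2 * ∫ y : ℝ, f y := by
  rw [Measure.integral_comp_mul_left (fun y => f (y - t)) 2, integral_sub_right_eq_self,
    real_smul]
  norm_num

theorem LogSurface.log_inv (τ : LogSurface) : (τ⁻¹).log = -τ.log := rfl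

/-- The series for `h(s, π τ n²)` as an integral of the completed zeta function. -/
theorem IsOddPolarKernel.two_mul_tsum (hg : IsOddPolarKernel a b C g)
    {h : ℂ → LogSurface → ℂ} (hana : AnalyticOnDomain a b h) (hmel : HasMellinGamma a g h)
    {τ : LogSurface} (hτ : |τ.arg| < Real.pi / 2 - b) {s : ℂ} (hs : -a < s.re) {d : ℝ}
    (hd : max (1 - s.re) 0 < d) (hda : d < a) :
    2 * ∑' n : ℕ, h s (LogSurface.ofReal (Real.pi * ((n : ℝ) + 1) ^ 2) * τ) =
      cexp (-(s / 2 * τ.log)) *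
        (1 / (2 * Real.pi) * ∫ y : ℝ, zetaKernel g s τ.log (d + y * I)) := by
  have hd0 : 0 < d := (le_max_right _ _).trans_lt hd
  have hds : 1 - s.re < d := (le_max_left _ _).trans_lt hd
  -- The abscissa that `v = 2w - s` carries to `Re v = d`; the Jacobian `1/2` of this substitution
  -- cancels the `2` before the series.
  have hc : IsAdmissible a s ((d + s.re) / 2) := ⟨by linarith, by linarith, by linarith⟩
  have hterm : ∀ n : ℕ, h s (LogSurface.ofReal (Real.pi * ((n : ℝ) + 1) ^ 2) * τ) =
      mellinKernelIntegral g ((d + s.re) / 2) s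
        ((Real.log (Real.pi * ((n : ℝ) + 1) ^ 2) : ℝ) + τ.log) := fun n => by
    rw [hg.eq_mellinKernelIntegral hana hmel hs hc (by rwa [LogSurface.arg_ofReal_mul]),
      LogSurface.log_ofReal_mul]
  simp_rw [hterm]
  rw [hg.tsum_mellinKernelIntegral hc (by linarith) hτ]
  have hpt : ∀ y : ℝ, completedRiemannZeta (2 * (((d + s.re) / 2 : ℝ) + y * I)) *
      g (2 * (((d + s.re) / 2 : ℝ) + y * I) - s) *
        cexp (-((((d + s.re) / 2 : ℝ) + y * I) * τ.log)) =
      cexp (-(s / 2 * τ.log)) * zetaKernel g s τ.log (d + (2 * y - s.im : ℝ) * I) := by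
    intro y
    have h1 : (2 * (((d + s.re) / 2 : ℝ) + y * I) : ℂ) = (d + (2 * y - s.im : ℝ) * I) + s := by
      apply Complex.ext <;> simp
      ring
    have h2 : ((((d + s.re) / 2 : ℝ) : ℂ) + y * I) = ((d + (2 * y - s.im : ℝ) * I) + s) / 2 := by
      rw [← h1]; ring
    rw [zetaKernel, h1, h2, add_sub_cancel_right, mul_left_comm, ← Complex.exp_add]
    congr 2
    ring
  simp_rw [hpt]
  rw [integral_const_mul,
    integral_comp_two_mul_sub (fun y => zetaKernel g s τ.log (d + y * I)) s.im]
  ring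

/-- Under `v ↦ -v` the functional equation preserves the zeta factor, `-l` restores the exponential,
and the oddness of `g` gives the sign. -/
theorem IsOddPolarKernel.integral_zetaKernel_one_sub (hg : IsOddPolarKernel a b C g) (s l : ℂ)
    {d : ℝ} (hd : 0 < d) (hda : d < a) :
    ∫ y : ℝ, zetaKernel g (1 - s) (-l) (d + y * I) =
      -∫ y : ℝ, zetaKernel g s l ((-d : ℝ) + y * I) := by
  rw [← integral_neg_eq_self, ← integral_neg]
  congr 1
  funext y
  have h1 : (d : ℂ) + (-y : ℝ) * I = -(((-d : ℝ) : ℂ) + y * I) := by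
    push_cast; ring
  set v : ℂ := ((-d : ℝ) : ℂ) + y * I with hv
  have hre : v.re = -d := by simp [hv]
  have hv0 : v ≠ 0 := by
    intro h; rw [h] at hre; simp at hre; linarith
  rw [h1, zetaKernel, zetaKernel, hg.odd v (by rw [hre, abs_neg, abs_of_pos hd]; exact hda) hv0,
    show -v + (1 - s) = 1 - (v + s) by ring, completedRiemannZeta_one_sub, neg_mul_neg]
  ring

theorem IsOddPolarKernel.completedRiemannZeta_eq (hg : IsOddPolarKernel a b C g) (hC : 0 < C)
    (ha : 0 < a) {h : ℂ → LogSurface → ℂ} (hana : AnalyticOnDomain a b h)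
    (hmel : HasMellinGamma a g h) {τ : LogSurface} (hτ : |τ.arg| < Real.pi / 2 - b) {s : ℂ}
    (hs : 1 - a < s.re) (hsa : s.re < a) (hs₀ : s ≠ 0) (hs₁ : s ≠ 1) :
    completedRiemannZeta s =
      τ.cpow (s / 2) * (-g s + 2 * ∑' n : ℕ,
        h s (LogSurface.ofReal (Real.pi * ((n : ℝ) + 1) ^ 2) * τ)) +
      τ.cpow ((s - 1) / 2) * (-g (1 - s) + 2 * ∑' n : ℕ,
        h (1 - s) (LogSurface.ofReal (Real.pi * ((n : ℝ) + 1) ^ 2) * τ⁻¹)) := by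
  obtain ⟨d₁, hd₁, hd₁a⟩ := exists_between (show max (1 - s.re) 0 < a from
    max_lt (by linarith) ha)
  obtain ⟨d₂, hd₂, hd₂a⟩ := exists_between (show max s.re 0 < a from max_lt hsa ha)
  have hτ' : |(τ⁻¹).arg| < Real.pi / 2 - b := by
    simpa [LogSurface.arg, LogSurface.log_inv] using hτ
  rw [hg.two_mul_tsum hana hmel hτ (by linarith) hd₁ hd₁a,
    hg.two_mul_tsum hana hmel hτ' (s := 1 - s) (d := d₂)
      (by rw [sub_re, one_re]; linarith) (by simpa using hd₂) hd₂a,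
    LogSurface.log_inv, hg.integral_zetaKernel_one_sub s τ.log
      ((le_max_right _ _).trans_lt hd₂) hd₂a]
  have hres := hg.integral_zetaKernel_sub hC (l := τ.log) hτ hs₀ hs₁ hsa hs hd₁ hd₁a hd₂ hd₂a
  set J₁ := ∫ y : ℝ, zetaKernel g s τ.log (d₁ + y * I)
  set J₂ := ∫ y : ℝ, zetaKernel g s τ.log ((-d₂ : ℝ) + y * I)
  have hπ : (2 * Real.pi : ℂ) ≠ 0 := by
    exact_mod_cast (by positivity : (2 * Real.pi : ℝ) ≠ 0)
  have e1 : cexp (s / 2 * τ.log) * cexp (-(s / 2 * τ.log)) = 1 := by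
    rw [← Complex.exp_add]; simp
  have e2 : cexp ((s - 1) / 2 * τ.log) * cexp (-((1 - s) / 2 * -τ.log)) = 1 := by
    rw [← Complex.exp_add]
    ring_nf
    simp
  have hJ : 1 / (2 * Real.pi : ℂ) * (J₁ - J₂) = completedRiemannZeta s +
      g (1 - s) * cexp ((s - 1) / 2 * τ.log) + g s * cexp (s / 2 * τ.log) := by
    rw [hres]; field_simp
  simp only [LogSurface.cpow]
  linear_combination -hJ - (1 / (2 * Real.pi : ℂ) * J₁) * e1 + (1 / (2 * Real.pi : ℂ) * J₂) * e2

end ZetaRepresentation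

end

theorem theorem1 (a b C : ℝ) (g : ℂ → ℂ)
    (ha : 1 / 2 < a) (hb : b < Real.pi / 2) (hC : 0 < C)
    -- `g` is odd and analytic in the strip `|Re z| < a`, apart from the point `0`
    (hodd : ∀ z : ℂ, |z.re| < a → z ≠ 0 → g (-z) = -g z)
    (hana : DifferentiableOn ℂ g {z : ℂ | |z.re| < a ∧ z ≠ 0})
    -- at `0` it has a simple pole with residue `1`
    (hpole : Tendsto (fun z => z * g z) (𝓝[≠] 0) (𝓝 1))
    (hbound : ∀ z : ℂ, |z.re| < a → 1 < |z.im| → ‖g z‖ < C * Real.exp (b * |z.im| / 2)) :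
    -- (i)
    (∃ h : ℂ → LogSurface → ℂ, AnalyticOnDomain a b h ∧ HasMellinGamma a g h) ∧
    -- (ii)
    (∀ h : ℂ → LogSurface → ℂ, AnalyticOnDomain a b h → HasMellinGamma a g h →
      ∀ τ : LogSurface, |τ.arg| < Real.pi / 2 - b →
        (∀ s : ℂ, 1 - a < s.re → s.re < a → s ≠ 0 → s ≠ 1 →
          completedRiemannZeta s =
            τ.cpow (s / 2) * (-g s + 2 * ∑' n : ℕ,
              h s (LogSurface.ofReal (Real.pi * ((n : ℝ) + 1) ^ 2) * τ)) +
            τ.cpow ((s - 1) / 2) * (-g (1 - s) + 2 * ∑' n : ℕ,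
              h (1 - s) (LogSurface.ofReal (Real.pi * ((n : ℝ) + 1) ^ 2) * τ⁻¹))) ∧
        ConvergesAbsUniformly
          (fun n s => h s (LogSurface.ofReal (Real.pi * ((n : ℝ) + 1) ^ 2) * τ))
          {s : ℂ | 1 - a < s.re ∧ s.re < a} ∧
        ConvergesAbsUniformly
          (fun n s => h (1 - s) (LogSurface.ofReal (Real.pi * ((n : ℝ) + 1) ^ 2) * τ⁻¹))
          {s : ℂ | 1 - a < s.re ∧ s.re < a}) := by
  have ha₀ : 0 < a := by linarith
  have hg : IsOddPolarKernel a b C g := ⟨hb, hodd, hana, hpole, hbound⟩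
  refine ⟨⟨_, hg.analyticOnDomain ha₀, hg.hasMellinGamma ha₀⟩, fun h h₁ h₂ τ hτ =>
    ⟨fun s hs hsa hs₀ hs₁ => hg.completedRiemannZeta_eq hC ha₀ h₁ h₂ hτ hs hsa hs₀ hs₁,
      hg.convergesAbsUniformly ha₀ h₁ h₂ hτ, ?_⟩⟩
  have hτ' : |(τ⁻¹).arg| < Real.pi / 2 - b := by
    simpa [LogSurface.arg, LogSurface.log_inv] using hτ
  -- The second series is the first one for `τ⁻¹` at `1 - s`, and the strip is symmetric under this
  -- reflection.
  refine (hg.convergesAbsUniformly ha₀ h₁ h₂ hτ').comp (φ := fun s => 1 - s) (by fun_prop) ?_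
  rintro s ⟨hs, hsa⟩
  simp only [mem_ofPred_eq, sub_re, one_re]
  exact ⟨by linarith, by linarith⟩
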